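/- For $n\ge 2$ let $(x,y)=-3x_0y_0+x_1y_1+\dots+x_ny_n$ on $\mathbb R^{n+1}$, let $\mathfrak C=\{x : (x,x)<0,\ x_0>0\}$, and let hyperbolic space $\mathbb H^n$ be the set of rays of $\mathfrak C$; its ideal points are the isotropic rays in the closure of $\mathfrak C$. Let $\Gamma$ be the group generated by all reflections $R_e(x)=x-\frac{2(e,x)}{(e,e)}e$, $(e,e)>0$, that belong to the group $\Theta_n$ of linear automorphisms preserving the form, the lattice $\mathbb Z^{n+1}$ and $\mathfrak C$. A fundamental polyhedron of $\Gamma$ is the closure in $\mathbb H^n$ of a connected component of the complement of the mirrors of the reflections in $\Gamma$; such polyhedra exist for $2\le n\le 8$. Write $\overline P$ for the union of a polyhedron $P$ and its ideal points, viewed as a convex set in the projective (Klein) model $x_0=1$; the ideal vertices of $P$ are the vertices of $\overline P$ that are ideal points. Consider the following Coxeter diagram $D_n$, $2\le n\le 8$. The vertices $0,1,\dots,n$ form a path in which the edge $\{0,1\}$ has weight $6$, the edge $\{n-1,n\}$ has weight $4$, and all other edges have weight $3$. For $n\ge 4$ there is one more vertex $n+1$, joined to vertex $4$ by a heavy edge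 (weight $\infty$, angle $0$) if $n=4$, to vertex $5$ by an edge of weight $4$ if $n=5$, and to vertex $5$ by an edge of weight $3$ if $n=6,7,8$. Vertices that are not joined have weight $2$. For $n\ge4$ the vertex $3$ is coloured black. Let $2\le n\le 8$ and let $P$ be any fundamental polyhedron of $\Gamma$. Then $P$ has the Coxeter diagram $D_n$: its bounding hyperplanes correspond to the vertices of $D_n$, so that suitable outer normals $e_i$ satisfy $\frac{(e_i,e_j)}{\sqrt{(e_i,e_i)(e_j,e_j)}}=-\cos\frac{\pi}{m_{ij}}$ for $i\ne j$, where $m_{ij}$ is the weight (and the right-hand side is $-1$ for $m_{ij}=\infty$). Moreover: 1. If $n=2$ or $n=3$, then $\overline P$ is an $n$-dimensional simplex; $P$ is compact for $n=2$ and non-compact for $n=3$. 2. If $4\le n\le 8$, then $P$ is non-compact, and $\overline P$ is a pyramid whose base is the face of $\overline P$ in the hyperplane that corresponds to the black vertex. This base is combinatorially equivalent to a product of two simplices of positive dimensions with sum $n-1$. The polyhedron $P$ has exactly one ideal vertex, namely the apex of the pyramid. -/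

import Mathlib

/-!
The reflection group of the Lorentzian form `-3 x₀² + x₁² + ⋯ + xₙ²` and its fundamental polyhedra.
-/

noncomputable section

namespace LorentzThree

/-- The `(n+1)`-dimensional real vector space with coordinates `x₀, x₁, …, xₙ`. -/
abbrev Vec (n : ℕ) : Type := Fin (n + 1) → ℝ

/-- The symmetric bilinear form of the quadratic form `-3 x₀² + x₁² + ⋯ + xₙ²`. -/
def form {n : ℕ} (x y : Vec n) : ℝ :=
  -3 * x 0 * y 0 + ∑ i : Fin n, x i.succ * y i.succ

/-- The open convex cone `ℭ`: the component with `x₀ > 0` of the set of vectors of negative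
square. -/
def cone (n : ℕ) : Set (Vec n) := {x | form x x < 0 ∧ 0 < x 0}

/-- Hyperbolic `n`-space, the space of rays of `ℭ`. Every ray of `ℭ` contains exactly one vector
with `x₀ = 1`, and this vector represents it; the topology is the one induced from `ℝⁿ⁺¹`.
Ideal points (the isotropic rays in the closure of `ℭ`) are likewise represented by the vectors
with `x₀ = 1` and square zero. -/
def hyperbolicSpace (n : ℕ) : Set (Vec n) := {x | x ∈ cone n ∧ x 0 = 1}

/-- A vector of the lattice `ℤⁿ⁺¹`. -/
def IsIntegral {n : ℕ} (x : Vec n) : Prop := ∀ i, ∃ k : ℤ, x i = k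

/-- The group `Θₙ` of integral automorphisms of the form that preserve the cone `ℭ`
(so that they act on hyperbolic space). -/
def integralAutomorphisms (n : ℕ) : Subgroup (Vec n ≃ₗ[ℝ] Vec n) where
  carrier := {g | (∀ x y, form (g x) (g y) = form x y) ∧
    (∀ x, IsIntegral (g x) ↔ IsIntegral x) ∧ (∀ x, g x ∈ cone n ↔ x ∈ cone n)}
  mul_mem' := by
    rintro a b ⟨ha, ha', ha''⟩ ⟨hb, hb', hb''⟩
    refine ⟨fun x y => ?_, fun x => ?_, fun x => ?_⟩
    · rw [LinearEquiv.mul_apply, LinearEquiv.mul_apply, ha, hb]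
    · rw [LinearEquiv.mul_apply, ha', hb']
    · rw [LinearEquiv.mul_apply, ha'', hb'']
  one_mem' := ⟨fun _ _ => rfl, fun _ => Iff.rfl, fun _ => Iff.rfl⟩
  inv_mem' := by
    rintro a ⟨ha, ha', ha''⟩
    have key : ∀ x, a (a⁻¹ x) = x := fun x => LinearEquiv.apply_symm_apply a x
    refine ⟨fun x y => ?_, fun x => ?_, fun x => ?_⟩
    · rw [← ha, key, key]
    · rw [← ha', key]
    · rw [← ha'', key]

/-- `g` is the reflection `R_e` in the hyperplane orthogonal to `e`, a vector of positive square. -/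
def IsReflectionIn {n : ℕ} (g : Vec n ≃ₗ[ℝ] Vec n) (e : Vec n) : Prop :=
  0 < form e e ∧ ∀ x, g x = x - (2 * form e x / form e e) • e

/-- The group `Γ` generated by all reflections that belong to `Θₙ`. -/
def reflectionGroup (n : ℕ) : Subgroup (Vec n ≃ₗ[ℝ] Vec n) :=
  Subgroup.closure {g | g ∈ integralAutomorphisms n ∧ ∃ e, IsReflectionIn g e}

/-- The union, in hyperbolic space, of the mirrors of all reflections in `Γ`. -/
def mirrors (n : ℕ) : Set (Vec n) :=
  {x | x ∈ hyperbolicSpace n ∧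
    ∃ g ∈ reflectionGroup n, ∃ e, IsReflectionIn g e ∧ form e x = 0}

/-- `P` is a fundamental polyhedron (a `Γ`-cell) of the reflection group `Γ`: the closure, in
hyperbolic space, of a connected component of the complement of the mirrors of `Γ`. -/
def IsFundamentalPolyhedron (n : ℕ) (P : Set (Vec n)) : Prop :=
  ∃ x ∈ hyperbolicSpace n \ mirrors n,
    P = hyperbolicSpace n ∩
      closure (connectedComponentIn (hyperbolicSpace n \ mirrors n) x)

/-- The vectors `e i` are outer normals of `P`, one for each bounding hyperplane: `P` is the
intersection of the half-spaces `(e i, x) ≤ 0`, and none of these can be left out. -/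
def IsNormalSystem {n : ℕ} {ι : Type} (P : Set (Vec n)) (e : ι → Vec n) : Prop :=
  (∀ i, 0 < form (e i) (e i)) ∧
  P = {x | x ∈ hyperbolicSpace n ∧ ∀ i, form (e i) x ≤ 0} ∧
  ∀ j, P ≠ {x | x ∈ hyperbolicSpace n ∧ ∀ i, i ≠ j → form (e i) x ≤ 0}

/-- The entry of the Gram matrix that belongs to a pair of vertices of a Coxeter diagram of
weight `m`: dihedral angle `π / m`, where `m = 0` stands for `∞` (a heavy line, angle `0`), and the
diagonal has weight `1`. -/
def gramEntry (m : ℕ) : ℝ := if m = 0 then -1 else -Real.cos (Real.pi / m)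

/-- The polyhedron `P` has the Coxeter diagram with vertex set `ι` and weights `w`, where `e i` is
the outer normal of the hyperplane that corresponds to the vertex `i`. -/
def HasCoxeterDiagram {n : ℕ} {ι : Type} (P : Set (Vec n)) (e : ι → Vec n) (w : ι → ι → ℕ) :
    Prop :=
  IsNormalSystem P e ∧
  ∀ i j, form (e i) (e j) / √(form (e i) (e i) * form (e j) (e j)) = gramEntry (w i j)

/-- The weight between two vertices `i < j` of the diagram for dimension `n`, `2 ≤ n ≤ 8`. The
vertices `0, 1, …, n` form a path with weights `6, 3, …, 3, 4`. For `n ≥ 4` there is a further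
vertex `n + 1`: it is joined to the vertex `4` by a heavy line if `n = 4`, to the vertex `5` by an
edge of weight `4` if `n = 5`, and to the vertex `5` by an edge of weight `3` if `n ≥ 6`. -/
def edgeWeight (n i j : ℕ) : ℕ :=
  if j = i + 1 ∧ j ≤ n then (if i = 0 then 6 else if j = n then 4 else 3)
  else if j = n + 1 ∧ n = 4 ∧ i = 4 then 0
  else if j = n + 1 ∧ n = 5 ∧ i = 5 then 4
  else if j = n + 1 ∧ 6 ≤ n ∧ i = 5 then 3
  else 2

/-- The diagram for dimension `n`, on its first `k` vertices (it has `n + 1` vertices for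
`n = 2, 3`, and `n + 2` vertices for `n = 4, …, 8`). The black vertex, for `n ≥ 4`, is the
vertex `3`. -/
def diagram (n : ℕ) {k : ℕ} (i j : Fin k) : ℕ :=
  if i = j then 1 else edgeWeight n (min (i : ℕ) j) (max (i : ℕ) j)

/-- `P`, together with its ideal points, is an `n`-dimensional simplex. -/
def IsSimplex {n : ℕ} (P : Set (Vec n)) : Prop :=
  ∃ v : Fin (n + 1) → Vec n, AffineIndependent ℝ v ∧ closure P = convexHull ℝ (Set.range v)

/-- The faces of a convex polytope, including `∅` and the polytope itself, ordered by inclusion. -/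
abbrev FaceLattice {E : Type} [AddCommGroup E] [Module ℝ E] [TopologicalSpace E] (A : Set E) :
    Type :=
  {F : Set E // IsExposed ℝ A F}

/-- Two convex polytopes are combinatorially equivalent: their face lattices are isomorphic. -/
def CombEquiv {E F : Type} [AddCommGroup E] [Module ℝ E] [TopologicalSpace E]
    [AddCommGroup F] [Module ℝ F] [TopologicalSpace F] (A : Set E) (B : Set F) : Prop :=
  Nonempty (FaceLattice A ≃o FaceLattice B)

/-- The polytope `B` has the combinatorial type of a product of two simplices of positive
dimensions `k` and `l` with `k + l = d`. -/
def IsProductOfTwoSimplices {E : Type} [AddCommGroup E] [Module ℝ E] [TopologicalSpace E]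
    (d : ℕ) (B : Set E) : Prop :=
  ∃ k l : ℕ, 1 ≤ k ∧ 1 ≤ l ∧ k + l = d ∧
    CombEquiv B (stdSimplex ℝ (Fin (k + 1)) ×ˢ stdSimplex ℝ (Fin (l + 1)))

/-- The set `A` is the pyramid with base `B` and apex `a`. -/
def IsPyramid {E : Type} [AddCommGroup E] [Module ℝ E] (A B : Set E) (a : E) : Prop :=
  a ∉ affineSpan ℝ B ∧ A = convexHull ℝ (insert a B)

/-- The face in the hyperplane orthogonal to `e` of the polyhedron `P`, with its ideal points. -/
def faceIn {n : ℕ} (P : Set (Vec n)) (e : Vec n) : Set (Vec n) := {x | x ∈ closure P ∧ form e x = 0}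

/-- The ideal vertices of `P`: the vertices of its closure that are ideal points. -/
def idealVertices {n : ℕ} (P : Set (Vec n)) : Set (Vec n) :=
  {x | x ∈ Set.extremePoints ℝ (closure P) ∧ form x x = 0}

end LorentzThree

end

/-!
The proof is a direct form of Vinberg's algorithm for the form `-3 x₀² + x₁² + ⋯ + xₙ²`.

Reflections of the lattice come from roots: primitive lattice vectors of square `1`, `2`, or `6` with
`3 ∣ eᵢ` for `i ≥ 1` (`exists_isRoot`). The simple roots are `(1, 3, 0, …)`, the roots
`-eᵢ + eᵢ₊₁`, `-eₙ` of type `Bₙ`, and, for `n ≥ 4`, `(1, 1, 1, 1, 1)` or `(1, 1, 1, 1, 1, 1, 0, …)`. They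
cut out the cell `x₀ ≥ x₁ ≥ ⋯ ≥ xₙ ≥ 0`, `x₁ + ⋯ + x₅ ≤ 3 x₀`, which is a face of the cell for
`n = 8` (`InCell`). Two facts about this cell carry everything.

* It lies in the closed forward cone and meets its boundary at most in the ray of
  `(1, 1, 1, 1, 0, …)` (`InCell.form_nonpos`, `InCell.eq_of_isotropic`). The reason is that
  `(xᵢ - x₅) (x₀ - xᵢ) ≥ 0` for `i ≤ 4`.
* No mirror of a root passes through its interior (`root_neg`, `form_root_ne_zero`). By the
  rearrangement inequality it is enough to consider roots with decreasing nonnegative coordinates.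
  Such a root has a positive product with `(1, 3, 0, …)` or with `(1, 1, 1, 1, 1, 1, 0, …)`, since
  otherwise it would lie in the cell and have a nonpositive square. Reflection then lowers `e₀`, and
  only few roots, which are listed, do not stay in the range of the induction.

Hence the interior of the cell is a connected component of the complement of the mirrors. The lattice
being discrete, every point can be moved into the cell by the reflection group
(`SimpleSystem.exists_mem_cell`), so every fundamental polyhedron is an image `γ⁻¹` of the cell
(`SimpleSystem.exists_eq_cell`), and its Gram matrix is that of the simple roots.

The polyhedral claims are stated in the projective model, where `γ` acts by a projective map, so they
are proved for all `γ` at once in terms of the products `(αᵢ, γ x)`. For `n ≤ 3` the cone is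
simplicial. For `n ≥ 4` all walls except the black one pass through the ray of `(1, 1, 1, 1, 0, …)`,
which gives the pyramid (`isPyramid`). The remaining simple roots satisfy one linear relation
(`sum_form_simpleRoot`), whose two sides involve `3` and `n - 2` roots; it identifies the cone over the
base with the cone over a product of two simplices, and projectively equivalent polytopes have
isomorphic face lattices (`combEquiv_of_projective`).
-/

namespace LorentzThree

variable {n : ℕ}

/-! ### The form and its forward cone -/

/-- The form as a linear functional of its second argument. -/
def formL (x : Vec n) : Vec n →ₗ[ℝ] ℝ where
  toFun y := form x y
  map_add' y z := by
    simp only [form, Pi.add_apply, mul_add, Finset.sum_add_distrib]; ring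
  map_smul' c y := by
    simp only [form, Pi.smul_apply, smul_eq_mul, RingHom.id_apply, mul_add, Finset.mul_sum]
    congr 1
    · ring
    · exact Finset.sum_congr rfl fun i _ => by ring

lemma formL_apply (x y : Vec n) : formL x y = form x y := rfl

lemma form_comm (x y : Vec n) : form x y = form y x := by
  simp only [form, mul_comm (x _) (y _), mul_assoc]

lemma form_add_right (x y z : Vec n) : form x (y + z) = form x y + form x z := (formL x).map_add y z

lemma form_sub_right (x y z : Vec n) : form x (y - z) = form x y - form x z := (formL x).map_sub y z

lemma form_smul_right (c : ℝ) (x y : Vec n) : form x (c • y) = c * form x y :=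
  (formL x).map_smul c y

lemma form_add_left (x y z : Vec n) : form (x + y) z = form x z + form y z := by
  rw [form_comm, form_add_right, form_comm z x, form_comm z y]

lemma form_sub_left (x y z : Vec n) : form (x - y) z = form x z - form y z := by
  rw [form_comm, form_sub_right, form_comm z x, form_comm z y]

lemma form_smul_left (c : ℝ) (x y : Vec n) : form (c • x) y = c * form x y := by
  rw [form_comm, form_smul_right, form_comm]

lemma form_zero_right (x : Vec n) : form x 0 = 0 := (formL x).map_zero

lemma continuous_form (e : Vec n) : Continuous fun x : Vec n => form e x := by
  unfold form; fun_prop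

lemma continuous_form_self : Continuous fun x : Vec n => form x x := by
  unfold form; fun_prop

/-- The vector `(1, 0, …, 0)`. -/
def origin (n : ℕ) : Vec n := Pi.single 0 1

lemma form_origin (x : Vec n) : form (origin n) x = -3 * x 0 := by
  simp [form, origin, Fin.succ_ne_zero]

lemma origin_mem_cone : origin n ∈ cone n := by
  constructor
  · rw [form_origin]; simp [origin]
  · simp [origin]

/-- The reverse Cauchy–Schwarz inequality, in the form in which one of the two vectors may be
isotropic. -/
lemma form_neg_of_forward {x y : Vec n} (hx : form x x ≤ 0) (hx0 : 0 < x 0) (hy : y ∈ cone n) :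
    form x y < 0 := by
  obtain ⟨hy, hy0⟩ := hy
  have cs := Finset.sum_mul_sq_le_sq_mul_sq Finset.univ
    (fun i : Fin n => x i.succ) (fun i : Fin n => y i.succ)
  simp only [form] at *
  set S := ∑ i : Fin n, x i.succ * y i.succ
  have hA : ∑ i : Fin n, x i.succ ^ 2 ≤ 3 * x 0 ^ 2 := by
    simp only [sq]; linarith
  have hB : ∑ i : Fin n, y i.succ ^ 2 < 3 * y 0 ^ 2 := by
    simp only [sq]; linarith
  have hB0 : 0 ≤ ∑ i : Fin n, y i.succ ^ 2 := Finset.sum_nonneg fun i _ => sq_nonneg _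
  have h1 : S ^ 2 < (3 * x 0 * y 0) ^ 2 := by
    have h2 := mul_le_mul_of_nonneg_right hA hB0
    have h3 := mul_lt_mul_of_pos_left hB (show 0 < 3 * x 0 ^ 2 by positivity)
    nlinarith
  have h2 : S < 3 * x 0 * y 0 := lt_of_pow_lt_pow_left₀ 2 (by positivity) h1
  linarith

lemma smul_mem_cone {c : ℝ} (hc : 0 < c) {x : Vec n} (hx : x ∈ cone n) : c • x ∈ cone n := by
  refine ⟨?_, by simpa using mul_pos hc hx.2⟩
  rw [form_smul_right, form_smul_left, ← mul_assoc]
  exact mul_neg_of_pos_of_neg (by positivity) hx.1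

/-- A vector of the closed forward cone, moved towards the open forward cone, enters the latter. -/
lemma add_smul_mem_cone {x y : Vec n} (hx : form x x ≤ 0) (hx0 : 0 < x 0) (hy : y ∈ cone n)
    {s t : ℝ} (hs : 0 ≤ s) (ht : 0 < t) : s • x + t • y ∈ cone n := by
  have hxy := form_neg_of_forward hx hx0 hy
  have hy1 := hy.1
  have hy2 := hy.2
  constructor
  · simp only [form_add_right, form_smul_right, form_add_left, form_smul_left, form_comm y x]
    have h1 : s * (s * form x x) ≤ 0 :=
      mul_nonpos_of_nonneg_of_nonpos hs (mul_nonpos_of_nonneg_of_nonpos hs hx)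
    have h2 : s * (t * form x y) ≤ 0 :=
      mul_nonpos_of_nonneg_of_nonpos hs (mul_nonpos_of_nonneg_of_nonpos ht.le hxy.le)
    have h3 : t * (t * form y y) < 0 := mul_neg_of_pos_of_neg ht (mul_neg_of_pos_of_neg ht hy1)
    nlinarith
  · simp only [Pi.add_apply, Pi.smul_apply, smul_eq_mul]
    have := mul_nonneg hs hx0.le
    have := mul_pos ht hy2
    linarith

lemma convex_hyperbolicSpace : Convex ℝ (hyperbolicSpace n) := by
  rintro x ⟨hx, hx0⟩ y ⟨hy, hy0⟩ s t hs ht hst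
  refine ⟨?_, by simp [hx0, hy0, hst]⟩
  rcases ht.eq_or_lt with rfl | ht
  · obtain rfl : s = 1 := by linarith
    simpa using hx
  · exact add_smul_mem_cone hx.1.le hx.2 hy hs ht

/-- Every vector of the cone has a representative in hyperbolic space. -/
lemma inv_smul_mem_hyperbolicSpace {x : Vec n} (hx : x ∈ cone n) :
    (x 0)⁻¹ • x ∈ hyperbolicSpace n :=
  ⟨smul_mem_cone (inv_pos.2 hx.2) hx, by simp [hx.2.ne']⟩

/-! ### Isometries and reflections -/

section Isometry

variable {g : Vec n ≃ₗ[ℝ] Vec n}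

lemma form_apply_left (hg : g ∈ integralAutomorphisms n) (x y : Vec n) :
    form (g x) y = form x (g⁻¹ y) := by
  have key : g (g⁻¹ y) = y := LinearEquiv.apply_symm_apply g y
  rw [← hg.1 x, key]

lemma form_inv_left (hg : g ∈ integralAutomorphisms n) (x y : Vec n) :
    form (g⁻¹ x) y = form x (g y) := by
  simpa using form_apply_left (inv_mem hg) x y

/-- Automorphisms preserve the closed forward cone too. -/
lemma forward_apply (hg : g ∈ integralAutomorphisms n) {x : Vec n} (hx : form x x ≤ 0)
    (hx0 : 0 < x 0) : 0 < (g x) 0 := by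
  have h := form_neg_of_forward hx hx0 (((inv_mem hg).2.2 _).2 origin_mem_cone)
  rw [← form_apply_left hg, form_comm, form_origin] at h
  linarith

lemma IsReflectionIn.smul {e : Vec n} (h : IsReflectionIn g e) {c : ℝ} (hc : c ≠ 0) :
    IsReflectionIn g (c • e) := by
  refine ⟨?_, fun x => ?_⟩
  · rw [form_smul_left, form_smul_right, ← mul_assoc]
    exact mul_pos (mul_self_pos.2 hc) h.1
  · rw [h.2 x, form_smul_left, form_smul_left, form_smul_right, smul_smul]
    congr 2
    have := h.1.ne'
    field_simp

lemma IsReflectionIn.conj {e : Vec n} (h : IsReflectionIn g e) {a : Vec n ≃ₗ[ℝ] Vec n}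
    (ha : a ∈ integralAutomorphisms n) : IsReflectionIn (a * g * a⁻¹) (a e) := by
  refine ⟨by rw [ha.1]; exact h.1, fun x => ?_⟩
  have key : a (a⁻¹ x) = x := LinearEquiv.apply_symm_apply a x
  rw [LinearEquiv.mul_apply, LinearEquiv.mul_apply, h.2, map_sub, map_smul, key, ha.1,
    form_apply_left ha]

lemma exists_isReflectionIn {e : Vec n} (he : 0 < form e e) :
    ∃ g : Vec n ≃ₗ[ℝ] Vec n, IsReflectionIn g e := by
  have h : ((2 / form e e) • formL e) e = 2 := by
    simp [formL_apply, he.ne']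
  refine ⟨Module.reflection h, he, fun x => ?_⟩
  rw [Module.reflection_apply]
  simp only [LinearMap.smul_apply, formL_apply, smul_eq_mul]
  congr 2
  ring

lemma IsReflectionIn.form_apply {e : Vec n} (h : IsReflectionIn g e) (x y : Vec n) :
    form (g x) (g y) = form x y := by
  rw [h.2, h.2]
  simp only [form_sub_left, form_sub_right, form_smul_left, form_smul_right, form_comm x e]
  have := h.1.ne'
  field_simp
  ring

lemma IsReflectionIn.apply_apply {e : Vec n} (h : IsReflectionIn g e) (x : Vec n) :
    g (g x) = x := by
  rw [h.2 (g x), h.2 x]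
  simp only [form_sub_right, form_smul_right]
  rw [sub_sub, ← add_smul]
  have := h.1.ne'
  have h0 : 2 * form e x / form e e +
      2 * (form e x - 2 * form e x / form e e * form e e) / form e e = 0 := by
    field_simp; ring
  rw [h0, zero_smul, sub_zero]

lemma IsReflectionIn.apply_mem_cone {e : Vec n} (h : IsReflectionIn g e) {x : Vec n}
    (hx : x ∈ cone n) : g x ∈ cone n := by
  refine ⟨by rw [h.form_apply]; exact hx.1, ?_⟩
  have ho : g (origin n) ∈ cone n := by
    refine ⟨by rw [h.form_apply]; exact origin_mem_cone.1, ?_⟩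
    have h1 : (origin n) 0 = 1 := by simp [origin]
    have h2 : (g (origin n)) 0 = 1 + 6 * (e 0) ^ 2 / form e e := by
      rw [h.2, form_comm, form_origin, Pi.sub_apply, Pi.smul_apply, smul_eq_mul, h1]
      ring
    rw [h2]
    have := h.1
    positivity
  have h3 := form_neg_of_forward hx.1.le hx.2 ho
  rw [← h.form_apply, h.apply_apply, form_comm, form_origin] at h3
  linarith

end Isometry

/-! ### Roots -/

/-- The form on the lattice. -/
def iform (x y : Fin (n + 1) → ℤ) : ℤ := -3 * x 0 * y 0 + ∑ i : Fin n, x i.succ * y i.succ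

/-- A lattice vector as a real vector. -/
def toVec (x : Fin (n + 1) → ℤ) : Vec n := fun i => (x i : ℝ)

lemma form_toVec (x y : Fin (n + 1) → ℤ) : form (toVec x) (toVec y) = iform x y := by
  simp [form, toVec, iform]

/-- The roots of the lattice: lattice vectors of square `1`, `2` or `6`, where in the last case
all coordinates but the one at `0` are divisible by `3`. These are, up to a factor, the vectors
whose reflections preserve the lattice. -/
def IsRoot (e : Fin (n + 1) → ℤ) : Prop :=
  iform e e = 1 ∨ iform e e = 2 ∨ (iform e e = 6 ∧ ∀ i : Fin n, (3 : ℤ) ∣ e i.succ)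

lemma IsRoot.form_pos {e : Fin (n + 1) → ℤ} (he : IsRoot e) : 0 < form (toVec e) (toVec e) := by
  rw [form_toVec]
  rcases he with h | h | ⟨h, -⟩ <;> simp [h]

lemma IsRoot.isIntegral {e : Fin (n + 1) → ℤ} (he : IsRoot e) {g : Vec n ≃ₗ[ℝ] Vec n}
    (hg : IsReflectionIn g (toVec e)) {x : Vec n} (hx : IsIntegral x) : IsIntegral (g x) := by
  choose y hy using hx
  obtain rfl : x = toVec y := funext hy
  obtain ⟨k, hk⟩ : ∃ k : ℤ, 2 * iform e y = k * iform e e := by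
    rcases he with h | h | ⟨h, hd⟩
    · exact ⟨2 * iform e y, by rw [h]; ring⟩
    · exact ⟨iform e y, by rw [h]; ring⟩
    · have : (3 : ℤ) ∣ iform e y := by
        refine dvd_add ⟨-e 0 * y 0, by ring⟩ (Finset.dvd_sum fun i _ => ?_)
        exact Dvd.dvd.mul_right (hd i) _
      obtain ⟨k, hk⟩ := this
      exact ⟨k, by rw [h, hk]; ring⟩
  have hp := he.form_pos
  have hk' : 2 * form (toVec e) (toVec y) / form (toVec e) (toVec e) = k := by
    rw [div_eq_iff hp.ne', form_toVec, form_toVec]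
    exact_mod_cast hk
  intro i
  refine ⟨y i - k * e i, ?_⟩
  rw [hg.2, hk']
  simp [toVec]

lemma IsRoot.reflection_mem {e : Fin (n + 1) → ℤ} (he : IsRoot e) {g : Vec n ≃ₗ[ℝ] Vec n}
    (hg : IsReflectionIn g (toVec e)) : g ∈ integralAutomorphisms n :=
  ⟨hg.form_apply,
    fun x => ⟨fun h => by simpa [hg.apply_apply] using he.isIntegral hg h, he.isIntegral hg⟩,
    fun x => ⟨fun h => by simpa [hg.apply_apply] using hg.apply_mem_cone h, hg.apply_mem_cone⟩⟩

/-- A primitive lattice vector whose reflection preserves the lattice is a root: its square `N`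
divides `2 (e, v)` for every lattice vector `v`, hence divides `6`, and `N = 3` is impossible
modulo `3`. -/
lemma isRoot_of_dvd {e : Fin (n + 1) → ℤ} (hpos : 0 < iform e e)
    (hprim : Finset.univ.gcd e = 1) (h0 : ∀ i, iform e e ∣ 6 * e 0 * e i)
    (hs : ∀ (j : Fin n) i, iform e e ∣ 2 * e j.succ * e i) : IsRoot e := by
  have key : ∀ m : ℤ, (∀ i, iform e e ∣ m * e i) → iform e e ∣ m := by
    intro m hm
    have h1 : iform e e ∣ Finset.univ.gcd fun i => m * e i := Finset.dvd_gcd fun i _ => hm i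
    rw [Finset.gcd_mul_left, hprim, mul_one] at h1
    exact (dvd_normalize_iff).1 h1
  have h0' := key _ h0
  have hs' : ∀ j : Fin n, iform e e ∣ 2 * e j.succ := fun j => key _ (hs j)
  have h6 : iform e e ∣ 6 := by
    refine key 6 fun i => ?_
    refine Fin.cases h0' (fun j => ?_) i
    exact ((hs' j).mul_left 3).trans ⟨1, by ring⟩
  have hle := Int.le_of_dvd (by norm_num) h6
  generalize hN : iform e e = N at *
  have hN' : N = 1 ∨ N = 2 ∨ N = 3 ∨ N = 6 := by
    interval_cases N <;> simp_all
  have h3 : (3 : ℤ) ∣ N → ∀ i : Fin n, (3 : ℤ) ∣ e i.succ := fun h i => by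
    have := h.trans (hs' i); omega
  rcases hN' with h | h | h | h
  · left; omega
  · right; left; omega
  · exfalso
    have hd := h3 (by omega)
    choose c hc using hd
    have h9 : ∑ i : Fin n, e i.succ * e i.succ = 9 * ∑ i : Fin n, c i * c i := by
      rw [Finset.mul_sum]
      exact Finset.sum_congr rfl fun i _ => by rw [hc]; ring
    rw [iform, h9, h] at hN
    generalize ∑ i : Fin n, c i * c i = t at hN
    have hmod : (e 0 * e 0) % 3 = 0 ∨ (e 0 * e 0) % 3 = 1 := by
      have : e 0 % 3 = 0 ∨ e 0 % 3 = 1 ∨ e 0 % 3 = 2 := by omega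
      rcases this with h | h | h <;> simp [Int.mul_emod, h]
    rw [mul_assoc] at hN
    omega
  · right; right; exact ⟨by omega, h3 (by omega)⟩

/-- The matrix entries of a reflection of the lattice are integers. -/
lemma IsReflectionIn.exists_int {g : Vec n ≃ₗ[ℝ] Vec n} (hg : g ∈ integralAutomorphisms n)
    {e : Vec n} (he : IsReflectionIn g e) {v : Vec n} (hv : IsIntegral v) (i : Fin (n + 1)) :
    ∃ k : ℤ, 2 * form e v / form e e * e i = k := by
  obtain ⟨a, ha⟩ := hv i
  obtain ⟨b, hb⟩ := (hg.2.1 v).2 hv i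
  refine ⟨a - b, ?_⟩
  rw [he.2] at hb
  simp only [Pi.sub_apply, Pi.smul_apply, smul_eq_mul] at hb
  push_cast
  linarith

lemma isIntegral_single (j : Fin (n + 1)) : IsIntegral (Pi.single j 1 : Vec n) := by
  intro i
  by_cases h : i = j
  · exact ⟨1, by simp [h]⟩
  · exact ⟨0, by simp [h]⟩

lemma form_single_zero (f : Vec n) : form f (Pi.single 0 1) = -3 * f 0 := by
  rw [form_comm]; exact form_origin f

lemma form_single_succ (f : Vec n) (j : Fin n) : form f (Pi.single j.succ 1) = f j.succ := by
  simp [form, Pi.single_apply, (Fin.succ_ne_zero j).symm]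

/-- Every reflection of the lattice is the reflection of a root. -/
lemma exists_isRoot {g : Vec n ≃ₗ[ℝ] Vec n} (hg : g ∈ integralAutomorphisms n) {e : Vec n}
    (he : IsReflectionIn g e) : ∃ r : Fin (n + 1) → ℤ, IsRoot r ∧ ∃ c : ℝ, e = c • toVec r := by
  have hN := he.1
  -- a multiple of `e` is a lattice vector
  obtain ⟨f, c, hc, hf⟩ :
      ∃ (f : Fin (n + 1) → ℤ) (c : ℝ), c ≠ 0 ∧ toVec f = c • e := by
    obtain ⟨v, hv, hev⟩ : ∃ v : Vec n, IsIntegral v ∧ form e v ≠ 0 := by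
      by_contra! hcon
      have h0 : ∀ i, e i = 0 := by
        intro i
        refine Fin.cases ?_ (fun j => ?_) i
        · have := hcon _ (isIntegral_single 0); rw [form_single_zero] at this; linarith
        · have := hcon _ (isIntegral_single j.succ); rwa [form_single_succ] at this
      rw [show e = 0 from funext h0, form_zero_right] at hN
      exact lt_irrefl _ hN
    choose f hf using he.exists_int hg hv
    exact ⟨f, _, div_ne_zero (mul_ne_zero two_ne_zero hev) hN.ne', funext fun i => (hf i).symm⟩
  -- so is a multiple with coprime coordinates
  obtain ⟨r, hr, hprim⟩ := Finset.extract_gcd f (s := Finset.univ) Finset.univ_nonempty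
  have hfr : toVec f = ((Finset.univ.gcd f : ℤ) : ℝ) • toVec r := by
    funext i
    simp only [toVec, Pi.smul_apply, smul_eq_mul]
    exact_mod_cast hr i (Finset.mem_univ i)
  set d : ℝ := ((Finset.univ.gcd f : ℤ) : ℝ)
  have her : e = (c⁻¹ * d) • toVec r := by
    rw [mul_smul, ← hfr, hf, smul_smul, inv_mul_cancel₀ hc, one_smul]
  have hcd : c⁻¹ * d ≠ 0 := by
    intro h0
    rw [her, h0, zero_smul, form_zero_right] at hN
    exact lt_irrefl _ hN
  have hgr : IsReflectionIn g (toVec r) := by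
    have := he.smul (inv_ne_zero hcd)
    rwa [her, smul_smul, inv_mul_cancel₀ hcd, one_smul] at this
  have hpos := hgr.1
  have hpos' : 0 < iform r r := by rw [form_toVec] at hpos; exact_mod_cast hpos
  refine ⟨r, isRoot_of_dvd hpos' hprim (fun i => ?_) (fun j i => ?_), _, her⟩
  · obtain ⟨k, hk⟩ := hgr.exists_int hg (isIntegral_single 0) i
    rw [form_single_zero, div_mul_eq_mul_div, div_eq_iff hpos.ne', form_toVec] at hk
    refine ⟨-k, ?_⟩
    simp only [toVec] at hk
    have hk' : 2 * (-3 * r 0) * r i = k * iform r r := by exact_mod_cast hk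
    linarith
  · obtain ⟨k, hk⟩ := hgr.exists_int hg (isIntegral_single j.succ) i
    rw [form_single_succ, div_mul_eq_mul_div, div_eq_iff hpos.ne', form_toVec] at hk
    refine ⟨k, ?_⟩
    simp only [toVec] at hk
    have hk' : 2 * r j.succ * r i = k * iform r r := by exact_mod_cast hk
    linarith

/-! ### The polyhedral cone in dimension eight -/

/-- The closed polyhedral cone `x₀ ≥ x₁ ≥ ⋯ ≥ x₈ ≥ 0`, `x₁ + ⋯ + x₅ ≤ 3 x₀`. The cones in lower
dimensions are obtained from it by setting the last coordinates to zero. -/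
def InCell (X : ℕ → ℝ) : Prop :=
  X 1 ≤ X 0 ∧ X 2 ≤ X 1 ∧ X 3 ≤ X 2 ∧ X 4 ≤ X 3 ∧ X 5 ≤ X 4 ∧ X 6 ≤ X 5 ∧ X 7 ≤ X 6 ∧ X 8 ≤ X 7 ∧
    0 ≤ X 8 ∧ X 1 + X 2 + X 3 + X 4 + X 5 ≤ 3 * X 0

/-- The interior of the polyhedral cone. -/
def InOpenCell (X : ℕ → ℝ) : Prop :=
  X 1 < X 0 ∧ X 2 < X 1 ∧ X 3 < X 2 ∧ X 4 < X 3 ∧ X 5 < X 4 ∧ X 6 < X 5 ∧ X 7 < X 6 ∧ X 8 < X 7 ∧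
    0 < X 8 ∧ X 1 + X 2 + X 3 + X 4 + X 5 < 3 * X 0

/-- The defect of the form on the polyhedral cone. With `m = x₅` one has
`xᵢ² = (x₀ + m) xᵢ - m x₀ - (xᵢ - m) (x₀ - xᵢ)` for `i ≤ 4` and `xᵢ ≤ m` for `i ≥ 5`. -/
lemma InCell.sum_sq_le {X : ℕ → ℝ} (h : InCell X) :
    X 1 ^ 2 + X 2 ^ 2 + X 3 ^ 2 + X 4 ^ 2 + X 5 ^ 2 + X 6 ^ 2 + X 7 ^ 2 + X 8 ^ 2
      + (X 5 * (2 * X 0 - 3 * X 5) + (X 1 - X 5) * (X 0 - X 1) + (X 2 - X 5) * (X 0 - X 2)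
        + (X 3 - X 5) * (X 0 - X 3) + (X 4 - X 5) * (X 0 - X 4)) ≤ 3 * X 0 ^ 2 := by
  obtain ⟨h1, h2, h3, h4, h5, h6, h7, h8, h9, hs⟩ := h
  have h6' : X 6 ^ 2 ≤ X 5 ^ 2 := pow_le_pow_left₀ (by linarith) h6 2
  have h7' : X 7 ^ 2 ≤ X 6 ^ 2 := pow_le_pow_left₀ (by linarith) h7 2
  have h8' : X 8 ^ 2 ≤ X 7 ^ 2 := pow_le_pow_left₀ (by linarith) h8 2
  have key := mul_le_mul_of_nonneg_left hs (show 0 ≤ X 0 + X 5 by linarith)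
  nlinarith

lemma InCell.defect_nonneg {X : ℕ → ℝ} (h : InCell X) :
    0 ≤ X 5 * (2 * X 0 - 3 * X 5) ∧ 0 ≤ (X 1 - X 5) * (X 0 - X 1) ∧
      0 ≤ (X 2 - X 5) * (X 0 - X 2) ∧ 0 ≤ (X 3 - X 5) * (X 0 - X 3) ∧
      0 ≤ (X 4 - X 5) * (X 0 - X 4) := by
  obtain ⟨h1, h2, h3, h4, h5, h6, h7, h8, h9, hs⟩ := h
  refine ⟨?_, ?_, ?_, ?_, ?_⟩ <;> apply mul_nonneg <;> linarith

/-- The polyhedral cone lies in the closed forward cone. -/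
lemma InCell.form_nonpos {X : ℕ → ℝ} (h : InCell X) :
    X 1 ^ 2 + X 2 ^ 2 + X 3 ^ 2 + X 4 ^ 2 + X 5 ^ 2 + X 6 ^ 2 + X 7 ^ 2 + X 8 ^ 2 ≤ 3 * X 0 ^ 2 := by
  have h1 := h.sum_sq_le
  have h2 := h.defect_nonneg
  linarith [h2.1, h2.2.1, h2.2.2.1, h2.2.2.2.1, h2.2.2.2.2]

/-- The only isotropic ray of the polyhedral cone is the one of `(1, 1, 1, 1, 0, …, 0)`. -/
lemma InCell.eq_of_isotropic {X : ℕ → ℝ} (h : InCell X) (h0 : 0 < X 0)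
    (hX : 3 * X 0 ^ 2 ≤
      X 1 ^ 2 + X 2 ^ 2 + X 3 ^ 2 + X 4 ^ 2 + X 5 ^ 2 + X 6 ^ 2 + X 7 ^ 2 + X 8 ^ 2) :
    X 1 = X 0 ∧ X 2 = X 0 ∧ X 3 = X 0 ∧ X 4 = 0 ∧ X 5 = 0 ∧ X 6 = 0 ∧ X 7 = 0 ∧ X 8 = 0 := by
  have hd := h.sum_sq_le
  obtain ⟨d5, d1, d2, d3, d4⟩ := h.defect_nonneg
  obtain ⟨h1, h2, h3, h4, h5, h6, h7, h8, h9, hs⟩ := h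
  have p5 : X 5 * (2 * X 0 - 3 * X 5) = 0 := by linarith
  have e5 : X 5 = 0 := by
    rcases mul_eq_zero.1 p5 with h | h <;> linarith
  have key : ∀ t : ℝ, (t - X 5) * (X 0 - t) = 0 → t = 0 ∨ t = X 0 := by
    intro t ht
    rcases mul_eq_zero.1 ht with h | h
    · left; linarith
    · right; linarith
  have e1 := key (X 1) (by linarith)
  have e2 := key (X 2) (by linarith)
  have e3 := key (X 3) (by linarith)
  have e4 := key (X 4) (by linarith)
  have e6 : X 6 = 0 := by linarith
  have e7 : X 7 = 0 := by linarith
  have e8 : X 8 = 0 := by linarith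
  have hsq : 0 < X 0 ^ 2 := by positivity
  rcases e4 with e4 | e4
  · rcases e3 with e3 | e3
    · rw [e3, e4, e5, e6, e7, e8] at hX
      have : X 1 ^ 2 ≤ X 0 ^ 2 := pow_le_pow_left₀ (by linarith) h1 2
      have : X 2 ^ 2 ≤ X 1 ^ 2 := pow_le_pow_left₀ (by linarith) h2 2
      nlinarith
    · exact ⟨by linarith, by linarith, e3, e4, e5, e6, e7, e8⟩
  · linarith

/-! ### No mirror meets the interior in dimension eight -/

/-- The roots in dimension eight, with the coordinate at `0` split off. -/
def IsRootPair (m : ℤ) (a : Fin 8 → ℤ) : Prop :=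
  -3 * m * m + ∑ i, a i * a i = 1 ∨ -3 * m * m + ∑ i, a i * a i = 2 ∨
    (-3 * m * m + ∑ i, a i * a i = 6 ∧ ∀ i, (3 : ℤ) ∣ a i)

/-- The rearrangement inequality reduces to coefficients that are nonnegative and decreasing. -/
lemma exists_antitone {a : Fin 8 → ℤ} {x : Fin 8 → ℝ} (hx : Antitone x) (hx0 : ∀ i, 0 ≤ x i) :
    ∃ σ : Equiv.Perm (Fin 8), Antitone (fun i => |a (σ i)|) ∧
      ∑ i, (a i : ℝ) * x i ≤ ∑ i, (|a (σ i)| : ℤ) * x i := by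
  set σ := Tuple.sort (fun i => -|a i|)
  have hσ : Monotone fun i => -|a (σ i)| := Tuple.monotone_sort (fun i => -|a i|)
  have hanti : Antitone fun i => |a (σ i)| := fun i j hij => neg_le_neg_iff.1 (hσ hij)
  refine ⟨σ, hanti, ?_⟩
  have hmono : Monovary (fun i => ((|a (σ i)| : ℤ) : ℝ)) x := by
    intro i j hij
    have : j ≤ i := by
      by_contra! hlt
      exact absurd (hx hlt.le) (not_le.2 hij)
    exact Int.cast_le.2 (hanti this)
  calc ∑ i, (a i : ℝ) * x i ≤ ∑ i, ((|a i| : ℤ) : ℝ) * x i := by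
        refine Finset.sum_le_sum fun i _ => mul_le_mul_of_nonneg_right ?_ (hx0 i)
        exact_mod_cast le_abs_self (a i)
    _ = ∑ i, ((|a (σ (σ⁻¹ i))| : ℤ) : ℝ) * x i := by simp
    _ ≤ ∑ i, (|a (σ i)| : ℤ) * x i := hmono.sum_comp_perm_mul_le_sum_mul (σ := σ⁻¹)

lemma isRootPair_iff {m b1 b2 b3 b4 b5 b6 b7 b8 : ℤ} :
    IsRootPair m ![b1, b2, b3, b4, b5, b6, b7, b8] ↔
      -3 * m * m + (b1 * b1 + b2 * b2 + b3 * b3 + b4 * b4 + b5 * b5 + b6 * b6 + b7 * b7 + b8 * b8)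
          = 1 ∨
        -3 * m * m + (b1 * b1 + b2 * b2 + b3 * b3 + b4 * b4 + b5 * b5 + b6 * b6 + b7 * b7 + b8 * b8)
          = 2 ∨
        (-3 * m * m + (b1 * b1 + b2 * b2 + b3 * b3 + b4 * b4 + b5 * b5 + b6 * b6 + b7 * b7 + b8 * b8)
          = 6 ∧ 3 ∣ b1 ∧ 3 ∣ b2 ∧ 3 ∣ b3 ∧ 3 ∣ b4 ∧ 3 ∣ b5 ∧ 3 ∣ b6 ∧ 3 ∣ b7 ∧ 3 ∣ b8) := by
  simp [IsRootPair, Fin.sum_univ_succ, Fin.forall_fin_succ, add_assoc]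

/-- A root with decreasing nonnegative coordinates `e₁ ≥ e₂ ≥ ⋯` and `e₁ ≥ 2 e₀ > 0` is
`(1, 2, 0, …)`, `(1, 2, 1, 0, …)` or `(1, 3, 0, …)`, hence negative on the cell. -/
lemma neg_of_two_mul_le {m b1 b2 b3 b4 b5 b6 b7 b8 : ℤ} (hm : 0 < m) (h2 : b2 ≤ b1)
    (h3 : b3 ≤ b2) (h4 : b4 ≤ b3) (h5 : b5 ≤ b4) (h6 : b6 ≤ b5) (h7 : b7 ≤ b6) (h8 : b8 ≤ b7)
    (h9 : 0 ≤ b8) (hr : IsRootPair m ![b1, b2, b3, b4, b5, b6, b7, b8]) (hb : 2 * m ≤ b1)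
    {X : ℕ → ℝ} (hX : InOpenCell X) :
    b1 * X 1 + b2 * X 2 + b3 * X 3 + b4 * X 4 + b5 * X 5 + b6 * X 6 + b7 * X 7 + b8 * X 8
      < 3 * m * X 0 := by
  obtain ⟨x1, x2, x3, x4, x5, x6, x7, x8, x9, hs⟩ := hX
  have hsq : (2 * m) * (2 * m) ≤ b1 * b1 := mul_self_le_mul_self (by linarith) hb
  have q3 := mul_self_le_mul_self (by linarith) h3
  have q4 := mul_self_nonneg b4
  have q5 := mul_self_nonneg b5
  have q6 := mul_self_nonneg b6
  have q7 := mul_self_nonneg b7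
  have q8 := mul_self_nonneg b8
  have q2 := mul_self_nonneg b3
  have zero : b3 = 0 → b4 = 0 ∧ b5 = 0 ∧ b6 = 0 ∧ b7 = 0 ∧ b8 = 0 := by
    intro h; omega
  have hN : ∀ N : ℤ, N ≤ 2 → -3 * m * m + (b1 * b1 + b2 * b2 + b3 * b3 + b4 * b4 + b5 * b5
      + b6 * b6 + b7 * b7 + b8 * b8) = N → m = 1 ∧ b1 = 2 ∧ (b2 = 0 ∨ b2 = 1) ∧ b3 = 0 := by
    intro N hN2 hN
    have hm1 : m < 2 := lt_of_mul_self_lt_mul_self₀ (by norm_num) (by linarith)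
    obtain rfl : m = 1 := by omega
    have hb1 : b1 < 3 := lt_of_mul_self_lt_mul_self₀ (by norm_num) (by linarith)
    obtain rfl : b1 = 2 := by omega
    have hb2 : b2 < 2 := lt_of_mul_self_lt_mul_self₀ (by norm_num) (by linarith)
    have hb3 : b3 < 1 := lt_of_mul_self_lt_mul_self₀ (by norm_num) (by linarith)
    omega
  rw [isRootPair_iff] at hr
  have fin1 : m = 1 ∧ b1 = 2 ∧ (b2 = 0 ∨ b2 = 1) ∧ b3 = 0 →
      b1 * X 1 + b2 * X 2 + b3 * X 3 + b4 * X 4 + b5 * X 5 + b6 * X 6 + b7 * X 7 + b8 * X 8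
        < 3 * m * X 0 := by
    rintro ⟨rfl, rfl, hb2, hb3⟩
    obtain ⟨rfl, rfl, rfl, rfl, rfl⟩ := zero hb3
    subst hb3
    rcases hb2 with rfl | rfl <;> push_cast <;> linarith
  rcases hr with hr | hr | ⟨hr, d1, d2, d3, -⟩
  · exact fin1 (hN 1 (by norm_num) hr)
  · exact fin1 (hN 2 (by norm_num) hr)
  · have hm2 : m < 3 := lt_of_mul_self_lt_mul_self₀ (by norm_num) (by linarith [mul_self_nonneg b2])
    have hmm : m * m ≤ 2 * 2 := mul_self_le_mul_self hm.le (by linarith)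
    have hb1 : b1 < 5 :=
      lt_of_mul_self_lt_mul_self₀ (by norm_num) (by linarith [mul_self_nonneg b2])
    obtain rfl : m = 1 := by omega
    obtain rfl : b1 = 3 := by omega
    have hb2 : b2 < 1 := lt_of_mul_self_lt_mul_self₀ (by norm_num) (by linarith)
    obtain rfl : b2 = 0 := by omega
    obtain rfl : b3 = 0 := by omega
    obtain ⟨rfl, rfl, rfl, rfl, rfl⟩ := zero rfl
    push_cast
    linarith

/-- A root with decreasing nonnegative coordinates `e₀ ≥ e₁ ≥ e₂ ≥ ⋯`, `e₀ > 0` and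
`e₁ + ⋯ + e₅ ≥ 4 e₀` is `(1, 1, 1, 1, 1, 0, …)`, `(1, 1, 1, 1, 1, 1, 0, …)` or
`(2, 2, 2, 2, 1, 1, 0, …)`, hence negative on the cell. -/
lemma neg_of_four_mul_le {m b1 b2 b3 b4 b5 b6 b7 b8 : ℤ} (hm : 0 < m) (h1 : b1 ≤ m) (h2 : b2 ≤ b1)
    (h3 : b3 ≤ b2) (h4 : b4 ≤ b3) (h5 : b5 ≤ b4) (h6 : b6 ≤ b5) (h7 : b7 ≤ b6) (h8 : b8 ≤ b7)
    (h9 : 0 ≤ b8) (hr : IsRootPair m ![b1, b2, b3, b4, b5, b6, b7, b8])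
    (hb : 4 * m ≤ b1 + b2 + b3 + b4 + b5) {X : ℕ → ℝ} (hX : InOpenCell X) :
    b1 * X 1 + b2 * X 2 + b3 * X 3 + b4 * X 4 + b5 * X 5 + b6 * X 6 + b7 * X 7 + b8 * X 8
      < 3 * m * X 0 := by
  obtain ⟨x1, x2, x3, x4, x5, x6, x7, x8, x9, hs⟩ := hX
  have q6 := mul_self_nonneg b6
  have q7 := mul_self_nonneg b7
  have q8 := mul_self_nonneg b8
  -- between consecutive integers `t`, `t + 1` there is no integer
  have tangent : ∀ t b : ℤ, (2 * t + 1) * b - t * (t + 1) ≤ b * b := by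
    intro t b
    rcases le_or_gt b t with h | h
    · nlinarith
    · nlinarith [show t + 1 ≤ b from h]
  -- Cauchy–Schwarz bounds `e₀`
  have bound : ∀ N : ℤ, -3 * m * m + (b1 * b1 + b2 * b2 + b3 * b3 + b4 * b4 + b5 * b5
      + b6 * b6 + b7 * b7 + b8 * b8) = N → m * m ≤ 5 * N := by
    intro N hN
    have hcs : (b1 + b2 + b3 + b4 + b5) * (b1 + b2 + b3 + b4 + b5)
        ≤ 5 * (b1 * b1 + b2 * b2 + b3 * b3 + b4 * b4 + b5 * b5) := by
      linarith [mul_self_nonneg (b1 - b2), mul_self_nonneg (b1 - b3), mul_self_nonneg (b1 - b4),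
        mul_self_nonneg (b1 - b5), mul_self_nonneg (b2 - b3), mul_self_nonneg (b2 - b4),
        mul_self_nonneg (b2 - b5), mul_self_nonneg (b3 - b4), mul_self_nonneg (b3 - b5),
        mul_self_nonneg (b4 - b5)]
    have := mul_self_le_mul_self (by linarith) hb
    linarith
  rw [isRootPair_iff] at hr
  have small : ∀ N : ℤ, N ≤ 2 → -3 * m * m + (b1 * b1 + b2 * b2 + b3 * b3 + b4 * b4
      + b5 * b5 + b6 * b6 + b7 * b7 + b8 * b8) = N →
      (m = 1 ∧ b1 = 1 ∧ b2 = 1 ∧ b3 = 1 ∧ b4 = 1 ∧ (b5 = 0 ∨ b5 = 1) ∧ b6 = 0) ∨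
        (m = 2 ∧ b1 = 2 ∧ b2 = 2 ∧ b3 = 2 ∧ b4 = 1 ∧ b5 = 1 ∧ b6 = 0) := by
    intro N hN2 hN
    have hmm := bound N hN
    have hm3 : m < 4 := lt_of_mul_self_lt_mul_self₀ (by norm_num) (by linarith)
    have hm' : m = 1 ∨ m = 2 ∨ m = 3 := by omega
    rcases hm' with rfl | rfl | rfl
    · left
      have hb6 : b6 ≤ 0 := by
        by_contra! hcon
        linarith [tangent 0 b1, tangent 0 b2, tangent 0 b3, tangent 0 b4, tangent 0 b5,
          tangent 0 b6]
      omega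
    · right
      have t1 := tangent 1 b1
      have t2 := tangent 1 b2
      have t3 := tangent 1 b3
      have t4 := tangent 1 b4
      have t5 := tangent 1 b5
      have hb6 : b6 < 1 := lt_of_mul_self_lt_mul_self₀ (by norm_num) (by linarith)
      have s1 := tangent 2 b1
      have s2 := tangent 2 b2
      have s3 := tangent 2 b3
      have s4 := tangent 2 b4
      have hb4 : b4 ≤ 1 := by
        by_contra! hcon
        linarith [mul_self_nonneg b5]
      have hb5 : 1 ≤ b5 := by omega
      omega
    · exfalso
      have t1 := tangent 2 b1
      have t2 := tangent 2 b2
      have t3 := tangent 2 b3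
      have t4 := tangent 2 b4
      have t5 := tangent 2 b5
      omega
  have fin : (m = 1 ∧ b1 = 1 ∧ b2 = 1 ∧ b3 = 1 ∧ b4 = 1 ∧ (b5 = 0 ∨ b5 = 1) ∧ b6 = 0) ∨
        (m = 2 ∧ b1 = 2 ∧ b2 = 2 ∧ b3 = 2 ∧ b4 = 1 ∧ b5 = 1 ∧ b6 = 0) →
      b1 * X 1 + b2 * X 2 + b3 * X 3 + b4 * X 4 + b5 * X 5 + b6 * X 6 + b7 * X 7 + b8 * X 8
        < 3 * m * X 0 := by
    intro h
    obtain ⟨rfl, rfl, rfl⟩ : b6 = 0 ∧ b7 = 0 ∧ b8 = 0 := by omega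
    rcases h with ⟨rfl, rfl, rfl, rfl, rfl, rfl | rfl, -⟩ | ⟨rfl, rfl, rfl, rfl, rfl, rfl, -⟩ <;>
      push_cast <;> linarith
  rcases hr with hr | hr | ⟨hr, ⟨c1, rfl⟩, ⟨c2, rfl⟩, ⟨c3, rfl⟩, ⟨c4, rfl⟩, ⟨c5, rfl⟩, -⟩
  · exact fin (small 1 (by norm_num) hr)
  · exact fin (small 2 (by norm_num) hr)
  · exfalso
    have hmm := bound 6 hr
    have hr' : -3 * m * m + (9 * (c1 * c1 + c2 * c2 + c3 * c3 + c4 * c4 + c5 * c5)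
        + b6 * b6 + b7 * b7 + b8 * b8) = 6 := by linarith
    clear hr
    have hm5 : m < 6 := lt_of_mul_self_lt_mul_self₀ (by norm_num) (by linarith)
    have t1 := tangent 0 c1
    have t2 := tangent 0 c2
    have t3 := tangent 0 c3
    have t4 := tangent 0 c4
    have t5 := tangent 0 c5
    have hm' : m = 1 ∨ m = 2 ∨ m = 3 ∨ m = 4 ∨ m = 5 := by omega
    rcases hm' with rfl | rfl | rfl | rfl | rfl <;> omega

/-- Every root with `e₀ > 0` is negative on the interior of the cell. The proof is by descent on
`e₀`: a root with sorted nonnegative coordinates cannot have nonpositive products with all simple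
roots, since it would then lie in the cell, that is, in the closed forward cone. So it can be
reflected in `(1, 3, 0, …)` or in `(1, 1, 1, 1, 1, 1, 0, …)`, which lowers `e₀`. -/
lemma root_neg {X : ℕ → ℝ} (hX : InOpenCell X) (k : ℕ) : ∀ (m : ℤ) (a : Fin 8 → ℤ), m.toNat = k →
    0 < m → IsRootPair m a → ∑ i : Fin 8, (a i : ℝ) * X (i + 1) < 3 * m * X 0 := by
  induction k using Nat.strong_induction_on with
  | _ k ih =>
  intro m a hk hm ha
  have hX' := hX
  obtain ⟨x1, x2, x3, x4, x5, x6, x7, x8, x9, hs⟩ := hX'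
  have hanti : Antitone fun i : Fin 8 => X (i + 1) := by
    rw [Fin.antitone_iff_succ_le]
    intro i
    fin_cases i <;> simp <;> linarith
  have hpos : ∀ i : Fin 8, 0 ≤ X (i + 1) := by
    intro i
    fin_cases i <;> simp <;> linarith
  obtain ⟨σ, hσ, hle⟩ := exists_antitone (a := a) hanti hpos
  have hsum : ∑ i, |a (σ i)| * |a (σ i)| = ∑ i, a i * a i := by
    rw [← Equiv.sum_comp σ (fun i => a i * a i)]
    exact Finset.sum_congr rfl fun i _ => abs_mul_abs_self _
  have hb : IsRootPair m fun i => |a (σ i)| := by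
    unfold IsRootPair
    rw [hsum]
    exact ha.imp_right (Or.imp_right (And.imp_right fun h i => (dvd_abs _ _).2 (h _)))
  refine lt_of_le_of_lt hle ?_
  -- explicit coordinates
  obtain ⟨b1, b2, b3, b4, b5, b6, b7, b8, hbb⟩ :
      ∃ b1 b2 b3 b4 b5 b6 b7 b8 : ℤ,
        (fun i => |a (σ i)|) = ![b1, b2, b3, b4, b5, b6, b7, b8] :=
    ⟨|a (σ 0)|, |a (σ 1)|, |a (σ 2)|, |a (σ 3)|, |a (σ 4)|, |a (σ 5)|, |a (σ 6)|, |a (σ 7)|,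
      funext fun i => by fin_cases i <;> rfl⟩
  have hb0 : ∀ i, 0 ≤ |a (σ i)| := fun i => abs_nonneg _
  have hb0' : 0 ≤ (fun i => |a (σ i)|) 7 := hb0 7
  have hval : ∑ i : Fin 8, ((|a (σ i)| : ℤ) : ℝ) * X (i + 1) =
      ∑ i : Fin 8, (((fun i => |a (σ i)|) i : ℤ) : ℝ) * X (i + 1) := rfl
  rw [hval]
  rw [hbb] at hσ hb hb0' ⊢
  have g2 : b2 ≤ b1 := hσ (show (0 : Fin 8) ≤ 1 by decide)
  have g3 : b3 ≤ b2 := hσ (show (1 : Fin 8) ≤ 2 by decide)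
  have g4 : b4 ≤ b3 := hσ (show (2 : Fin 8) ≤ 3 by decide)
  have g5 : b5 ≤ b4 := hσ (show (3 : Fin 8) ≤ 4 by decide)
  have g6 : b6 ≤ b5 := hσ (show (4 : Fin 8) ≤ 5 by decide)
  have g7 : b7 ≤ b6 := hσ (show (5 : Fin 8) ≤ 6 by decide)
  have g8 : b8 ≤ b7 := hσ (show (6 : Fin 8) ≤ 7 by decide)
  have g9 : 0 ≤ b8 := hb0'
  have hexp : ∀ c1 c2 c3 c4 c5 c6 c7 c8 : ℤ,
      ∑ i : Fin 8, ((![c1, c2, c3, c4, c5, c6, c7, c8] i : ℤ) : ℝ) * X (i + 1) =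
      c1 * X 1 + c2 * X 2 + c3 * X 3 + c4 * X 4 + c5 * X 5 + c6 * X 6 + c7 * X 7 + c8 * X 8 := by
    intros
    simp [Fin.sum_univ_succ, add_assoc]
  rw [hexp]
  by_cases h1 : b1 ≤ m
  · by_cases h5 : b1 + b2 + b3 + b4 + b5 ≤ 3 * m
    · -- the root lies in the cell, hence in the closed forward cone
      exfalso
      have hc : InCell fun i =>
          ((![m, b1, b2, b3, b4, b5, b6, b7, b8] : Fin 9 → ℤ) (Fin.ofNat 9 i) : ℝ) := by
        simp only [InCell]
        refine ⟨?_, ?_, ?_, ?_, ?_, ?_, ?_, ?_, ?_, ?_⟩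
        iterate 9 first | exact Int.cast_le.2 ‹_› | exact Int.cast_nonneg g9
        have h : ((b1 + b2 + b3 + b4 + b5 : ℤ) : ℝ) ≤ ((3 * m : ℤ) : ℝ) := Int.cast_le.2 h5
        push_cast at h
        exact h
      have hf := hc.form_nonpos
      have hf' : (b1 : ℝ) ^ 2 + b2 ^ 2 + b3 ^ 2 + b4 ^ 2 + b5 ^ 2 + b6 ^ 2 + b7 ^ 2 + b8 ^ 2
        ≤ 3 * (m : ℝ) ^ 2 := hf
      have hf'' : b1 ^ 2 + b2 ^ 2 + b3 ^ 2 + b4 ^ 2 + b5 ^ 2 + b6 ^ 2 + b7 ^ 2 + b8 ^ 2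
        ≤ 3 * m ^ 2 := by exact_mod_cast hf'
      rw [isRootPair_iff] at hb
      rcases hb with hb | hb | ⟨hb, -⟩ <;> linarith
    · push Not at h5
      by_cases h4 : 4 * m ≤ b1 + b2 + b3 + b4 + b5
      · exact neg_of_four_mul_le hm h1 g2 g3 g4 g5 g6 g7 g8 g9 hb h4 hX
      · push Not at h4
        -- reflect in `(1, 1, 1, 1, 1, 1, 0, …)`
        obtain ⟨t, ht⟩ : ∃ t, t = b1 + b2 + b3 + b4 + b5 - 3 * m := ⟨_, rfl⟩
        have hb' : IsRootPair (m - t) ![b1 - t, b2 - t, b3 - t, b4 - t, b5 - t, b6, b7, b8] := by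
          have hsq : -3 * (m - t) * (m - t) + ((b1 - t) * (b1 - t) + (b2 - t) * (b2 - t)
              + (b3 - t) * (b3 - t) + (b4 - t) * (b4 - t) + (b5 - t) * (b5 - t)
              + b6 * b6 + b7 * b7 + b8 * b8) = -3 * m * m + (b1 * b1 + b2 * b2 + b3 * b3 + b4 * b4
              + b5 * b5 + b6 * b6 + b7 * b7 + b8 * b8) := by rw [ht]; ring
          rw [isRootPair_iff] at hb ⊢
          rw [hsq]
          refine hb.imp_right (Or.imp_right (And.imp_right fun h => ?_))
          omega
        have := ih _ (by omega) (m - t) _ rfl (by omega) hb'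
        rw [hexp] at this
        push_cast at this
        have ht0 : (0 : ℝ) < t := Int.cast_pos.2 (by omega)
        nlinarith [mul_lt_mul_of_pos_left hs ht0]
  · push Not at h1
    by_cases h2 : 2 * m ≤ b1
    · exact neg_of_two_mul_le hm g2 g3 g4 g5 g6 g7 g8 g9 hb h2 hX
    · push Not at h2
      -- reflect in `(1, 3, 0, …)`
      have hb' : IsRootPair (2 * m - b1) ![3 * m - 2 * b1, b2, b3, b4, b5, b6, b7, b8] := by
        have hsq : -3 * (2 * m - b1) * (2 * m - b1) + ((3 * m - 2 * b1) * (3 * m - 2 * b1)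
            + b2 * b2 + b3 * b3 + b4 * b4 + b5 * b5 + b6 * b6 + b7 * b7 + b8 * b8) =
            -3 * m * m + (b1 * b1 + b2 * b2 + b3 * b3 + b4 * b4 + b5 * b5 + b6 * b6 + b7 * b7
            + b8 * b8) := by ring
        rw [isRootPair_iff] at hb ⊢
        rw [hsq]
        refine hb.imp_right (Or.imp_right (And.imp_right fun h => ?_))
        omega
      have := ih _ (by omega) (2 * m - b1) _ rfl (by omega) hb'
      rw [hexp] at this
      push_cast at this
      have ht0 : (0 : ℝ) < b1 - m := by
        have : (m : ℝ) < b1 := Int.cast_lt.2 h1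
        linarith
      nlinarith [mul_lt_mul_of_pos_left x1 ht0]

/-! ### Simple systems and fundamental polyhedra -/

/-- A simple system of roots: pairwise at nonacute angles, with a lattice vector of the forward
cone strictly inside the cell `(αᵢ, x) ≤ 0`, such that no mirror of a root meets the interior of
this cell and the cell lies in the closed forward cone. -/
structure SimpleSystem {ι : Type} (α : ι → Fin (n + 1) → ℤ) : Prop where
  isRoot : ∀ i, IsRoot (α i)
  acute : ∀ i j, i ≠ j → iform (α i) (α j) ≤ 0
  interior : ∃ p : Fin (n + 1) → ℤ, toVec p ∈ cone n ∧ ∀ i, iform (α i) p < 0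
  no_mirror : ∀ x : Vec n, (∀ i, form (toVec (α i)) x < 0) → ∀ e, IsRoot e → form (toVec e) x ≠ 0
  forward : ∀ x : Vec n, (∀ i, form (toVec (α i)) x ≤ 0) → x ≠ 0 → form x x ≤ 0 ∧ 0 < x 0

lemma reflectionGroup_le : reflectionGroup n ≤ integralAutomorphisms n :=
  (Subgroup.closure_le _).2 fun _ h => h.1

lemma IsRoot.exists_reflection {e : Fin (n + 1) → ℤ} (he : IsRoot e) :
    ∃ s ∈ reflectionGroup n, IsReflectionIn s (toVec e) := by
  obtain ⟨s, hs⟩ := exists_isReflectionIn he.form_pos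
  exact ⟨s, Subgroup.subset_closure ⟨he.reflection_mem hs, _, hs⟩, hs⟩

lemma abs_le_of_mem_cone {q : Vec n} (hq : q ∈ cone n) (i : Fin (n + 1)) : |q i| ≤ 2 * q 0 := by
  obtain ⟨hq, hq0⟩ := hq
  refine Fin.cases ?_ (fun j => ?_) i
  · rw [abs_of_pos hq0]; linarith
  · have h1 : q j.succ * q j.succ ≤ ∑ i : Fin n, q i.succ * q i.succ :=
      Finset.single_le_sum (f := fun i : Fin n => q i.succ * q i.succ)
        (fun i _ => mul_self_nonneg _) (Finset.mem_univ j)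
    rw [form] at hq
    refine abs_le_of_sq_le_sq ?_ (by linarith)
    nlinarith

/-- Only finitely many lattice vectors of the forward cone have bounded product with a given
vector of that cone. -/
lemma finite_lattice {x : Vec n} (hx : x ∈ cone n) (C : ℝ) :
    {q : Fin (n + 1) → ℤ | toVec q ∈ cone n ∧ C ≤ form (toVec q) x}.Finite := by
  -- `x` stays in the open cone when a small multiple of `(1, 0, …, 0)` is subtracted
  obtain ⟨ε, hε, hxε⟩ : ∃ ε : ℝ, 0 < ε ∧ x - ε • origin n ∈ cone n := by
    have hopen : IsOpen (cone n) :=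
      (isOpen_lt continuous_form_self continuous_const).inter
        (isOpen_lt continuous_const (continuous_apply 0))
    have hc : Continuous fun ε : ℝ => x - ε • origin n := by fun_prop
    have h0 : ∀ᶠ ε in nhds (0 : ℝ), x - ε • origin n ∈ cone n :=
      hc.continuousAt.eventually_mem (hopen.mem_nhds (by simpa using hx))
    obtain ⟨δ, hδ, h⟩ := Metric.eventually_nhds_iff.1 h0
    exact ⟨δ / 2, by positivity, h (by rw [dist_zero_right, Real.norm_of_nonneg] <;> linarith)⟩
  obtain ⟨B, hB⟩ := exists_int_gt (2 * (-C / (3 * ε)))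
  refine (Set.finite_Icc (fun _ => -B : Fin (n + 1) → ℤ) (fun _ => B)).subset ?_
  rintro q ⟨hq, hqC⟩
  have h1 := form_neg_of_forward hq.1.le hq.2 hxε
  rw [form_sub_right, form_smul_right, form_comm _ (origin n), form_origin] at h1
  have h2 : toVec q 0 ≤ -C / (3 * ε) := by
    rw [le_div_iff₀ (by positivity)]
    linarith
  have h3 : ∀ i, |q i| ≤ B := fun i => by
    have : |(q i : ℝ)| ≤ B := by
      have := abs_le_of_mem_cone hq i
      simp only [toVec] at this h2
      linarith
    exact_mod_cast this
  exact ⟨fun i => (abs_le.1 (h3 i)).1, fun i => (abs_le.1 (h3 i)).2⟩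

namespace SimpleSystem

variable {ι : Type} {α : ι → Fin (n + 1) → ℤ}

/-- The images of the cell under the reflection group cover the forward cone: an image `γ p` of an
interior lattice vector that is as close as possible to `x` is on the same side as `x` of all
walls of the corresponding image of the cell. -/
lemma exists_mem_cell (hα : SimpleSystem α) {x : Vec n} (hx : x ∈ cone n) :
    ∃ γ ∈ reflectionGroup n, ∀ i, form (toVec (α i)) (γ x) ≤ 0 := by
  obtain ⟨p, hp, hpα⟩ := hα.interior
  set S : Set (Fin (n + 1) → ℤ) :=
    {q | (∃ γ ∈ reflectionGroup n, γ (toVec p) = toVec q) ∧ form (toVec p) x ≤ form (toVec q) x}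
  have hfin : S.Finite := by
    refine (finite_lattice hx (form (toVec p) x)).subset ?_
    rintro q ⟨⟨γ, hγ, hq⟩, h⟩
    exact ⟨by rw [← hq]; exact ((reflectionGroup_le hγ).2.2 _).2 hp, h⟩
  have hne : S.Nonempty := ⟨p, ⟨1, one_mem _, rfl⟩, le_rfl⟩
  obtain ⟨q, ⟨⟨γ, hγ, hq⟩, hqp⟩, hmax⟩ := Set.exists_max_image S (fun q => form (toVec q) x) hfin hne
  refine ⟨γ⁻¹, inv_mem hγ, fun i => ?_⟩
  have hγΘ := reflectionGroup_le hγ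
  obtain ⟨s, hs, hse⟩ := (hα.isRoot i).exists_reflection
  obtain ⟨r, hr⟩ : ∃ r : Fin (n + 1) → ℤ, (γ * s) (toVec p) = toVec r := by
    have : IsIntegral ((γ * s) (toVec p)) :=
      ((reflectionGroup_le (mul_mem hγ hs)).2.1 _).2 fun i => ⟨p i, rfl⟩
    choose r hr using this
    exact ⟨r, funext hr⟩
  have hle : form (toVec r) x ≤ form (toVec q) x := by
    by_cases h : form (toVec p) x ≤ form (toVec r) x
    · exact hmax r ⟨⟨_, mul_mem hγ hs, hr⟩, h⟩
    · exact (not_le.1 h).le.trans hqp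
  rw [← hr, ← hq, LinearEquiv.mul_apply, form_apply_left hγΘ, form_apply_left hγΘ, hse.2,
    form_sub_left, form_smul_left] at hle
  have hneg : form (toVec (α i)) (toVec p) < 0 := by
    rw [form_toVec]; exact_mod_cast hpα i
  have hpos := (hα.isRoot i).form_pos
  by_contra! hcon
  have : 2 * form (toVec (α i)) (toVec p) / form (toVec (α i)) (toVec (α i)) *
      form (toVec (α i)) (γ⁻¹ x) < 0 :=
    mul_neg_of_neg_of_pos (div_neg_of_neg_of_pos (by linarith) hpos) hcon
  linarith

/-- Images of interior points of the cell lie on no mirror. -/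
lemma notMem_mirrors (hα : SimpleSystem α) {γ : Vec n ≃ₗ[ℝ] Vec n}
    (hγ : γ ∈ integralAutomorphisms n) {x : Vec n} (hx : ∀ i, form (toVec (α i)) (γ x) < 0) :
    x ∉ mirrors n := by
  rintro ⟨-, g, hg, e, hge, hex⟩
  have h := hge.conj hγ
  obtain ⟨r, hr, c, hc⟩ :=
    exists_isRoot (mul_mem (mul_mem hγ (reflectionGroup_le hg)) (inv_mem hγ)) h
  have hc0 : c ≠ 0 := by
    rintro rfl
    have := h.1
    rw [hc, zero_smul, form_zero_right] at this
    exact lt_irrefl _ this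
  rw [← hγ.1, hc, form_smul_left] at hex
  exact hα.no_mirror _ hx r hr ((mul_eq_zero.1 hex).resolve_left hc0)

/-- Fundamental polyhedra exist. -/
lemma exists_isFundamentalPolyhedron (hα : SimpleSystem α) :
    ∃ P, IsFundamentalPolyhedron n P := by
  obtain ⟨p, hp, hpα⟩ := hα.interior
  refine ⟨_, _, ⟨inv_smul_mem_hyperbolicSpace hp, ?_⟩, rfl⟩
  refine hα.notMem_mirrors (one_mem _) fun i => ?_
  have : form (toVec (α i)) (toVec p) < 0 := by
    rw [form_toVec]; exact_mod_cast hpα i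
  change form _ (((toVec p) 0)⁻¹ • toVec p) < 0
  rw [form_smul_right]
  exact mul_neg_of_pos_of_neg (inv_pos.2 hp.2) this

/-- The image of the cell under `γ⁻¹` with its ideal points, in the projective model. -/
def closedCell (α : ι → Fin (n + 1) → ℤ) (γ : Vec n ≃ₗ[ℝ] Vec n) : Set (Vec n) :=
  {x | x 0 = 1 ∧ ∀ i, form (toVec (α i)) (γ x) ≤ 0}

lemma forward_of_mem (hα : SimpleSystem α) {γ : Vec n ≃ₗ[ℝ] Vec n}
    (hγ : γ ∈ integralAutomorphisms n) {x : Vec n} (hx : ∀ i, form (toVec (α i)) (γ x) ≤ 0)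
    (hx0 : x ≠ 0) : form x x ≤ 0 ∧ 0 < x 0 := by
  obtain ⟨h1, h2⟩ := hα.forward (γ x) hx (by simpa using hx0)
  refine ⟨by rwa [hγ.1] at h1, ?_⟩
  have := forward_apply (inv_mem hγ) h1 h2
  rwa [show γ⁻¹ (γ x) = x from LinearEquiv.symm_apply_apply γ x] at this

/-- The walls of the cell are irredundant: since the angles are not acute, the mirror image of an
interior point in the `j`-th wall violates only the `j`-th inequality. -/
lemma exists_violating (hα : SimpleSystem α) (j : ι) :
    ∃ y ∈ cone n, (∀ i, i ≠ j → form (toVec (α i)) y ≤ 0) ∧ 0 < form (toVec (α j)) y := by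
  obtain ⟨p, hp, hpα⟩ := hα.interior
  obtain ⟨s, hs, hse⟩ := (hα.isRoot j).exists_reflection
  have hpos := (hα.isRoot j).form_pos
  have hneg : ∀ i, form (toVec (α i)) (toVec p) < 0 := fun i => by
    rw [form_toVec]; exact_mod_cast hpα i
  refine ⟨s (toVec p), hse.apply_mem_cone hp, fun i hij => ?_, ?_⟩
  · rw [hse.2, form_sub_right, form_smul_right]
    have h1 : form (toVec (α i)) (toVec (α j)) ≤ 0 := by
      rw [form_toVec]; exact_mod_cast hα.acute i j hij
    have h2 : 2 * form (toVec (α j)) (toVec p) / form (toVec (α j)) (toVec (α j)) ≤ 0 :=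
      div_nonpos_of_nonpos_of_nonneg (by linarith [hneg j]) hpos.le
    have h3 := mul_nonneg_of_nonpos_of_nonpos h2 h1
    linarith [hneg i]
  · rw [hse.2, form_sub_right, form_smul_right, div_mul_cancel₀ _ hpos.ne']
    linarith [hneg j]

/-- Every fundamental polyhedron is an image of the cell, and its closure in the projective model
adds the ideal points of the cell. -/
lemma exists_eq_cell [Finite ι] (hα : SimpleSystem α) {P : Set (Vec n)}
    (hP : IsFundamentalPolyhedron n P) :
    ∃ γ ∈ integralAutomorphisms n, IsNormalSystem P (fun i => γ⁻¹ (toVec (α i))) ∧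
      P = hyperbolicSpace n ∩ closedCell α γ ∧ closure P = closedCell α γ := by
  obtain ⟨x, ⟨hxH, hxm⟩, rfl⟩ := hP
  obtain ⟨γ, hγΓ, hγx⟩ := hα.exists_mem_cell hxH.1
  have hγ := reflectionGroup_le hγΓ
  have hcont : ∀ i, Continuous fun y : Vec n => form (toVec (α i)) (γ y) := fun i =>
    (continuous_form _).comp γ.toLinearMap.continuous_of_finiteDimensional
  have hwall : ∀ y ∈ hyperbolicSpace n \ mirrors n, ∀ i, form (toVec (α i)) (γ y) ≠ 0 := by
    rintro y ⟨hyH, hym⟩ i hi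
    obtain ⟨s, hs, hse⟩ := (hα.isRoot i).exists_reflection
    exact hym ⟨hyH, _, mul_mem (mul_mem (inv_mem hγΓ) hs) (inv_mem (inv_mem hγΓ)), _,
      hse.conj (inv_mem hγ), by rw [form_inv_left hγ]; exact hi⟩
  set C : Set (Vec n) := {y | y ∈ hyperbolicSpace n ∧ ∀ i, form (toVec (α i)) (γ y) < 0} with hC
  have hxC : x ∈ C := ⟨hxH, fun i => (hγx i).lt_of_ne (hwall x ⟨hxH, hxm⟩ i)⟩
  have hCm : C ⊆ hyperbolicSpace n \ mirrors n := fun y hy => ⟨hy.1, hα.notMem_mirrors hγ hy.2⟩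
  have hCconv : Convex ℝ C := by
    rintro y ⟨hy, hy'⟩ z ⟨hz, hz'⟩ s t hs ht hst
    refine ⟨convex_hyperbolicSpace hy hz hs ht hst, fun i => ?_⟩
    rw [map_add, map_smul, map_smul, form_add_right, form_smul_right, form_smul_right]
    rcases hs.eq_or_lt with rfl | hs
    · obtain rfl : t = 1 := by linarith
      simpa using hz' i
    · have h1 := mul_neg_of_pos_of_neg hs (hy' i)
      have h2 := mul_nonpos_of_nonneg_of_nonpos ht (hz' i).le
      linarith
  have hcomp : connectedComponentIn (hyperbolicSpace n \ mirrors n) x = C := by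
    refine Set.Subset.antisymm ?_
      (hCconv.isPreconnected.subset_connectedComponentIn hxC hCm)
    have hsub := connectedComponentIn_subset (hyperbolicSpace n \ mirrors n) x
    have hu : IsOpen {y : Vec n | ∀ i, form (toVec (α i)) (γ y) < 0} := by
      rw [Set.ofPred_forall]
      exact isOpen_iInter_of_finite fun i => isOpen_lt (hcont i) continuous_const
    have hv : IsOpen {y : Vec n | ∃ i, 0 < form (toVec (α i)) (γ y)} := by
      rw [Set.ofPred_exists]
      exact isOpen_iUnion fun i => isOpen_lt continuous_const (hcont i)
    have hxC' : x ∈ connectedComponentIn (hyperbolicSpace n \ mirrors n) x :=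
      mem_connectedComponentIn ⟨hxH, hxm⟩
    have := isPreconnected_connectedComponentIn.subset_left_of_subset_union hu hv
      (Set.disjoint_left.2 fun y hy ⟨i, hi⟩ => lt_asymm (hy i) hi)
      (fun y hy => by
        by_cases h : ∃ i, 0 < form (toVec (α i)) (γ y)
        · exact Or.inr h
        · push Not at h
          exact Or.inl fun i => (h i).lt_of_ne (hwall y (hsub hy) i))
      ⟨x, hxC', hxC.2⟩
    intro y hy
    exact ⟨(hsub hy).1, this hy⟩
  have hclosed : IsClosed (closedCell α γ) := by
    have h : IsClosed {y : Vec n | ∀ i, form (toVec (α i)) (γ y) ≤ 0} := by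
      rw [Set.ofPred_forall]
      exact isClosed_iInter fun i => isClosed_le (hcont i) continuous_const
    exact (isClosed_eq (continuous_apply 0) continuous_const).inter h
  have hCcl : C ⊆ closedCell α γ := fun y hy => ⟨hy.1.2, fun i => (hy.2 i).le⟩
  have hclC : closure C = closedCell α γ := by
    refine Set.Subset.antisymm (closure_minimal hCcl hclosed) fun q hq => ?_
    have hq0 : q ≠ 0 := by
      rintro rfl
      simpa using hq.1
    obtain ⟨hq1, hq2⟩ := hα.forward_of_mem hγ hq.2 hq0
    have hseg : openSegment ℝ q x ⊆ C := by
      rintro _ ⟨s, t, hs, ht, hst, rfl⟩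
      refine ⟨⟨add_smul_mem_cone hq1 hq2 hxH.1 hs.le ht, by simp [hq.1, hxH.2, hst]⟩, fun i => ?_⟩
      rw [map_add, map_smul, map_smul, form_add_right, form_smul_right, form_smul_right]
      have h1 := mul_nonpos_of_nonneg_of_nonpos hs.le (hq.2 i)
      have h2 := mul_neg_of_pos_of_neg ht (hxC.2 i)
      linarith
    refine closure_mono hseg ?_
    rw [closure_openSegment]
    exact left_mem_segment ℝ q x
  have hPeq : hyperbolicSpace n ∩ closure (connectedComponentIn (hyperbolicSpace n \ mirrors n) x)
      = hyperbolicSpace n ∩ closedCell α γ := by rw [hcomp, hclC]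
  rw [hPeq]
  refine ⟨γ, hγ, ⟨fun i => ?_, ?_, fun j => ?_⟩, rfl, ?_⟩
  · rw [(inv_mem hγ).1]
    exact (hα.isRoot i).form_pos
  · ext y
    simp only [form_inv_left hγ]
    exact ⟨fun h => ⟨h.1, h.2.2⟩, fun h => ⟨h.1, h.1.2, h.2⟩⟩
  · obtain ⟨y, hy, hyi, hyj⟩ := hα.exists_violating j
    have hy' : γ⁻¹ y ∈ cone n := ((inv_mem hγ).2.2 _).2 hy
    have key : ∀ i, form (γ⁻¹ (toVec (α i))) (((γ⁻¹ y) 0)⁻¹ • γ⁻¹ y) =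
        ((γ⁻¹ y) 0)⁻¹ * form (toVec (α i)) y := fun i => by
      rw [form_smul_right, (inv_mem hγ).1]
    have hpos : 0 < ((γ⁻¹ y) 0)⁻¹ := inv_pos.2 hy'.2
    intro heq
    have hmem : ((γ⁻¹ y) 0)⁻¹ • γ⁻¹ y ∈ hyperbolicSpace n ∩ closedCell α γ := by
      rw [heq]
      refine ⟨inv_smul_mem_hyperbolicSpace hy', fun i hij => ?_⟩
      rw [key]
      exact mul_nonpos_of_nonneg_of_nonpos hpos.le (hyi i hij)
    have h := hmem.2.2 j
    rw [← form_inv_left hγ, key] at h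
    exact absurd (mul_pos hpos hyj) (not_lt.2 h)
  · refine Set.Subset.antisymm (closure_minimal Set.inter_subset_right hclosed) ?_
    rw [← hclC]
    exact closure_mono fun y hy => ⟨hy.1, subset_closure hy⟩

end SimpleSystem

/-! ### The simple roots -/

/-- The simple roots. For `i ≤ n` they are `(1, 3, 0, …)` and the simple roots `-eᵢ + eᵢ₊₁`, `-eₙ`
of type `Bₙ`; the root with index `n + 1`, which is used for `n ≥ 4` only, is `(1, 1, 1, 1, 1)` for
`n = 4` and `(1, 1, 1, 1, 1, 1, 0, …)` for `n ≥ 5`. -/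
def simpleRoot (n i : ℕ) (j : Fin (n + 1)) : ℤ :=
  if i = 0 then (if (j : ℕ) = 0 then 1 else if (j : ℕ) = 1 then 3 else 0)
  else if i = n + 1 then (if (j : ℕ) ≤ 5 then 1 else 0)
  else if (j : ℕ) = i then -1 else if (j : ℕ) = i + 1 then 1 else 0

/-- The coordinates of a vector, continued by zeros. -/
def pad (x : Vec n) (i : ℕ) : ℝ := if h : i < n + 1 then x ⟨i, h⟩ else 0

lemma form_self_pad (hn : n ≤ 8) (x : Vec n) : form x x = -3 * pad x 0 ^ 2 +
    (pad x 1 ^ 2 + pad x 2 ^ 2 + pad x 3 ^ 2 + pad x 4 ^ 2 + pad x 5 ^ 2 + pad x 6 ^ 2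
      + pad x 7 ^ 2 + pad x 8 ^ 2) := by
  interval_cases n <;> simp [form, Fin.sum_univ_succ, pad, Fin.succ] <;> ring

/-- The products with the simple roots of index at most `n`. -/
lemma form_simpleRoot (hn : 2 ≤ n) (hn' : n ≤ 8) (x : Vec n) (i : ℕ) (hi : i ≤ n) :
    form (toVec (simpleRoot n i)) x =
      if i = 0 then 3 * (pad x 1 - pad x 0) else pad x (i + 1) - pad x i := by
  interval_cases n <;> interval_cases i <;>
    simp [form, Fin.sum_univ_succ, pad, Fin.succ, toVec, simpleRoot] <;> ring

lemma form_simpleRoot_last (hn : 4 ≤ n) (hn' : n ≤ 8) (x : Vec n) :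
    form (toVec (simpleRoot n (n + 1))) x =
      pad x 1 + pad x 2 + pad x 3 + pad x 4 + pad x 5 - 3 * pad x 0 := by
  interval_cases n <;> simp [form, Fin.sum_univ_succ, pad, Fin.succ, toVec, simpleRoot] <;> ring

lemma pad_of_lt (x : Vec n) {i : ℕ} (hi : n < i) : pad x i = 0 := dif_neg (by omega)

lemma pad_zero (x : Vec n) : pad x 0 = x 0 := rfl

lemma eq_of_pad {x y : Vec n} (h : ∀ i ≤ n, pad x i = pad y i) : x = y := by
  funext i
  have hi : (i : ℕ) ≤ n := by omega
  simpa [pad, hi] using h i hi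

lemma inCell_pad (hn : 2 ≤ n) (hn' : n ≤ 8) {x : Vec n}
    (h : ∀ i ≤ n, form (toVec (simpleRoot n i)) x ≤ 0)
    (hl : 4 ≤ n → form (toVec (simpleRoot n (n + 1))) x ≤ 0) : InCell (pad x) := by
  have step : ∀ i, pad x (i + 1) ≤ pad x i := by
    intro i
    by_cases hi : i ≤ n
    · have := h i hi
      rw [form_simpleRoot hn hn' x i hi] at this
      split_ifs at this with h0
      · subst h0; linarith
      · linarith
    · rw [pad_of_lt x (by omega), pad_of_lt x (by omega)]
  refine ⟨step 0, step 1, step 2, step 3, step 4, step 5, step 6, step 7, ?_, ?_⟩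
  · have := step 8
    rwa [pad_of_lt x (show n < 8 + 1 by omega)] at this
  · by_cases h4 : 4 ≤ n
    · have := hl h4
      rw [form_simpleRoot_last h4 hn'] at this
      linarith
    · rw [pad_of_lt x (show n < 4 by omega), pad_of_lt x (show n < 5 by omega)]
      linarith [step 0, step 1, step 2]

/-! ### No mirror meets the interior of the cell in lower dimensions -/

/-- A root with `e₀ = 0` is a combination of at most two coordinate vectors with signs. -/
lemma sum_ne_zero_of_isRootPair {a : Fin 8 → ℤ} (ha : IsRootPair 0 a) {x : Fin 8 → ℝ}
    (hx : ∀ i, 0 < x i) (hinj : Function.Injective x) : ∑ i, (a i : ℝ) * x i ≠ 0 := by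
  have ha2 : ∑ i, a i * a i = 1 ∨ ∑ i, a i * a i = 2 := by
    rcases ha with h | h | ⟨h, hd⟩
    · left; linarith
    · right; linarith
    · exfalso
      have : (9 : ℤ) ∣ ∑ i, a i * a i := Finset.dvd_sum fun i _ => mul_dvd_mul (hd i) (hd i)
      omega
  set s := Finset.univ.filter fun i => a i ≠ 0
  have hs : ∑ i, a i * a i = ∑ i ∈ s, a i * a i := by
    refine (Finset.sum_subset (Finset.subset_univ s) fun i _ hi => ?_).symm
    have : a i = 0 := by simpa [s] using hi
    rw [this]; rfl
  have hs' : ∑ i, (a i : ℝ) * x i = ∑ i ∈ s, (a i : ℝ) * x i := by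
    refine (Finset.sum_subset (Finset.subset_univ s) fun i _ hi => ?_).symm
    have : a i = 0 := by simpa [s] using hi
    rw [this]; simp
  have hne : ∀ i ∈ s, a i ≠ 0 := fun i hi => (Finset.mem_filter.1 hi).2
  have hone : ∀ i ∈ s, 1 ≤ a i * a i := fun i hi => by
    have := mul_self_pos.2 (hne i hi)
    omega
  have hcard : (s.card : ℤ) ≤ ∑ i ∈ s, a i * a i := by
    have := Finset.card_nsmul_le_sum s (fun i => a i * a i) 1 hone
    simpa using this
  have hsgn : ∀ i ∈ s, a i = 1 ∨ a i = -1 := by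
    intro i hi
    have h1 : a i * a i ≤ ∑ i ∈ s, a i * a i :=
      Finset.single_le_sum (f := fun i => a i * a i) (fun i _ => mul_self_nonneg _) hi
    have h2 : a i * a i < 2 * 2 := by omega
    have h3 := abs_lt_of_sq_lt_sq (a := a i) (b := 2) (by linarith) (by norm_num)
    have h4 := hne i hi
    rw [abs_lt] at h3
    omega
  have hpos : 0 < s.card := by
    rw [Finset.card_pos, Finset.nonempty_iff_ne_empty]
    intro h
    rw [hs, h] at ha2
    simp at ha2
  rw [hs']
  obtain hc | hc : s.card = 1 ∨ s.card = 2 := by omega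
  · obtain ⟨i, hi⟩ := Finset.card_eq_one.1 hc
    rw [hi, Finset.sum_singleton]
    exact mul_ne_zero (Int.cast_ne_zero.2 (hne i (by simp [hi]))) (hx i).ne'
  · obtain ⟨i, j, hij, hs2⟩ := Finset.card_eq_two.1 hc
    rw [hs2, Finset.sum_pair hij]
    have hxij := hinj.ne hij
    have := hx i
    have := hx j
    rcases hsgn i (by simp [hs2]) with h1 | h1 <;> rcases hsgn j (by simp [hs2]) with h2 | h2 <;>
      rw [h1, h2] <;> push_cast <;> intro h
    · linarith
    · exact hxij (by linarith)
    · exact hxij (by linarith)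
    · linarith

/-- No mirror of a root passes through the interior of the cell. The vector is continued by a small
decreasing sequence, which makes it an interior point of the cell in dimension eight. -/
lemma form_root_ne_zero (hn : 2 ≤ n) (hn' : n ≤ 8) {x : Vec n}
    (h : ∀ i ≤ n, form (toVec (simpleRoot n i)) x < 0)
    (hl : 4 ≤ n → form (toVec (simpleRoot n (n + 1))) x < 0) {e : Fin (n + 1) → ℤ}
    (he : IsRoot e) : form (toVec e) x ≠ 0 := by
  have step : ∀ i ≤ n, pad x (i + 1) < pad x i := by
    intro i hi
    have := h i hi
    rw [form_simpleRoot hn hn' x i hi] at this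
    split_ifs at this with h0
    · subst h0; linarith
    · linarith
  have hlast : 0 < pad x n := by
    have := step n le_rfl
    rwa [pad_of_lt x (Nat.lt_succ_self n)] at this
  have hsum : pad x 1 + pad x 2 + pad x 3 + pad x 4 + pad x 5 < 3 * pad x 0 := by
    by_cases h4 : 4 ≤ n
    · have := hl h4
      rw [form_simpleRoot_last h4 hn'] at this
      linarith
    · rw [pad_of_lt x (show n < 4 by omega), pad_of_lt x (show n < 5 by omega)]
      have h0 := step 0 (by omega)
      have h1 := step 1 (by omega)
      have h2 := step 2 (by omega)
      linarith
  set δ : ℝ := min (pad x n) (3 * pad x 0 - (pad x 1 + pad x 2 + pad x 3 + pad x 4 + pad x 5)) / 100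
  have hδ : 0 < δ := div_pos (lt_min hlast (by linarith)) (by norm_num)
  have hδ1 : 100 * δ ≤ pad x n := by
    have := min_le_left (pad x n) (3 * pad x 0 - (pad x 1 + pad x 2 + pad x 3 + pad x 4 + pad x 5))
    simp only [δ]; linarith
  have hδ2 : 100 * δ ≤ 3 * pad x 0 - (pad x 1 + pad x 2 + pad x 3 + pad x 4 + pad x 5) := by
    have := min_le_right (pad x n) (3 * pad x 0 - (pad x 1 + pad x 2 + pad x 3 + pad x 4 + pad x 5))
    simp only [δ]; linarith
  clear_value δ
  set Y : ℕ → ℝ := fun i => if i ≤ n then pad x i else δ * (9 - i) with hY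
  have hY0 : Y 0 = pad x 0 := by simp [hY]
  have hYstep : ∀ i < 8, Y (i + 1) < Y i := by
    intro i hi
    have hi9 : (i : ℝ) + 1 ≤ 8 := by exact_mod_cast hi
    simp only [hY]
    split_ifs with h1 h2 h2
    · exact step i h2
    · omega
    · obtain rfl : i = n := by omega
      push_cast
      have : (2 : ℝ) ≤ i := by exact_mod_cast hn
      nlinarith
    · push_cast
      linarith
  have hY8 : 0 < Y 8 := by
    simp only [hY]
    split_ifs with h1
    · obtain rfl : n = 8 := by omega
      exact hlast
    · norm_num; exact hδ
  have hYle : ∀ i, 1 ≤ i → i ≤ 8 → Y i ≤ pad x i + 8 * δ := by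
    intro i h1 h8
    simp only [hY]
    have h1' : (1 : ℝ) ≤ i := by exact_mod_cast h1
    split_ifs with h
    · linarith
    · rw [pad_of_lt x (by omega)]; nlinarith
  have hYopen : InOpenCell Y := by
    refine ⟨hYstep 0 (by norm_num), hYstep 1 (by norm_num), hYstep 2 (by norm_num),
      hYstep 3 (by norm_num), hYstep 4 (by norm_num), hYstep 5 (by norm_num),
      hYstep 6 (by norm_num), hYstep 7 (by norm_num), hY8, ?_⟩
    rw [hY0]
    have h1 := hYle 1 (by norm_num) (by norm_num)
    have h2 := hYle 2 (by norm_num) (by norm_num)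
    have h3 := hYle 3 (by norm_num) (by norm_num)
    have h4 := hYle 4 (by norm_num) (by norm_num)
    have h5 := hYle 5 (by norm_num) (by norm_num)
    linarith
  -- the root in dimension eight
  have main : ∀ f : Fin (n + 1) → ℤ, IsRoot f → ∃ a : Fin 8 → ℤ, IsRootPair (f 0) a ∧
      form (toVec f) x = -3 * f 0 * Y 0 + ∑ i : Fin 8, (a i : ℝ) * Y (i + 1) := by
    intro f hf
    have hsumeq : ∀ {R : Type} [AddCommMonoid R] (g : ℕ → R), (∀ i, n ≤ i → g i = 0) →
        ∑ i : Fin 8, g i = ∑ i : Fin n, g i := by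
      intro R _ g hg
      rw [Fin.sum_univ_eq_sum_range, Fin.sum_univ_eq_sum_range]
      exact (Finset.sum_subset (Finset.range_mono hn') fun i _ hi =>
        hg i (by simpa using hi)).symm
    set b : ℕ → ℤ := fun j => if hj : j + 1 < n + 1 then f ⟨j + 1, hj⟩ else 0 with hb
    have hbn : ∀ j, n ≤ j → b j = 0 := fun j hj => dif_neg (by omega)
    have hbf : ∀ i : Fin n, b i = f i.succ := fun i => dif_pos (Nat.succ_lt_succ i.2)
    refine ⟨fun j => b j, ?_, ?_⟩
    · have hsq : ∑ i : Fin 8, b i * b i = ∑ i : Fin n, f i.succ * f i.succ := by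
        rw [hsumeq (fun j => b j * b j) fun i hi => by rw [hbn i hi]; rfl]
        exact Finset.sum_congr rfl fun i _ => by rw [hbf]
      unfold IsRootPair
      rw [hsq]
      refine hf.imp_right (Or.imp_right (And.imp_right fun hd j => ?_))
      by_cases hj : (j : ℕ) < n
      · have : b j = _ := hbf ⟨j, hj⟩
        change (3 : ℤ) ∣ b j
        rw [this]
        exact hd _
      · change (3 : ℤ) ∣ b j
        rw [hbn j (by omega)]
        exact dvd_zero _
    · rw [hsumeq (fun j => (b j : ℝ) * Y (j + 1)) fun i hi => by rw [hbn i hi]; simp, form, hY0,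
        pad_zero]
      congr 1
      refine Finset.sum_congr rfl fun i _ => ?_
      rw [hbf]
      have : Y (i + 1) = x i.succ := by
        simp only [hY, pad]
        rw [if_pos (by omega), dif_pos (by omega)]
        rfl
      rw [this]
      rfl
  rcases lt_trichotomy (e 0) 0 with h0 | h0 | h0
  · have he' : IsRoot fun i => -e i := by
      have : iform (fun i => -e i) (fun i => -e i) = iform e e := by simp [iform]
      unfold IsRoot
      rw [this]
      exact he.imp_right (Or.imp_right (And.imp_right fun h i => (dvd_neg).2 (h i)))
    obtain ⟨a, ha, hform⟩ := main _ he'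
    have := root_neg hYopen _ _ a rfl (by omega) ha
    have hneg : form (toVec fun i => -e i) x = -form (toVec e) x := by
      have : toVec (fun i => -e i) = (-1 : ℝ) • toVec e := by funext i; simp [toVec]
      rw [this, form_smul_left]; ring
    rw [hneg] at hform
    intro hz
    linarith
  · obtain ⟨a, ha, hform⟩ := main e he
    rw [hform, h0]
    rw [h0] at ha
    simp only [Int.cast_zero, mul_zero, zero_mul, zero_add]
    have hanti : StrictAnti fun i : Fin 8 => Y (i + 1) := by
      rw [Fin.strictAnti_iff_succ_lt]
      intro i
      exact hYstep (i + 1) (by omega)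
    refine sum_ne_zero_of_isRootPair (x := fun i : Fin 8 => Y (i + 1)) ha (fun i => ?_)
      hanti.injective
    exact hY8.trans_le (hanti.antitone (Fin.le_last i))
  · obtain ⟨a, ha, hform⟩ := main e he
    have := root_neg hYopen _ _ a rfl h0 ha
    rw [hform]
    intro hz
    linarith

lemma forward_of_inCell (hn : n ≤ 8) {x : Vec n} (h : InCell (pad x)) (hx : x ≠ 0) :
    form x x ≤ 0 ∧ 0 < x 0 := by
  refine ⟨by rw [form_self_pad hn]; linarith [h.form_nonpos], ?_⟩
  obtain ⟨h1, h2, h3, h4, h5, h6, h7, h8, h9, hs⟩ := h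
  rw [← pad_zero x]
  by_contra! hcon
  refine hx (eq_of_pad fun i hi => ?_)
  have hz : pad (0 : Vec n) i = 0 := by simp [pad]
  rw [hz]
  have hi8 : i ≤ 8 := hi.trans hn
  interval_cases i <;> linarith

/-- The number of simple roots is `n + 1` for `n ≤ 3` and `n + 2` for `n ≥ 4`; they form a simple
system. -/
lemma simpleSystem {k : ℕ} (hn : 2 ≤ n) (hn' : n ≤ 8)
    (hk : n ≤ 3 ∧ k = n + 1 ∨ 4 ≤ n ∧ k = n + 2) :
    SimpleSystem fun i : Fin k => simpleRoot n i := by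
  have hle : ∀ {x : Vec n} {p : ℝ → Prop}, (∀ i : Fin k, p (form (toVec (simpleRoot n i)) x)) →
      (∀ i ≤ n, p (form (toVec (simpleRoot n i)) x)) ∧
        (4 ≤ n → p (form (toVec (simpleRoot n (n + 1))) x)) := fun h =>
    ⟨fun i hi => h ⟨i, by omega⟩, fun h4 => h ⟨n + 1, by omega⟩⟩
  refine ⟨?_, ?_, ?_, fun x hx e he => ?_, fun x hx hx0 => ?_⟩
  · unfold IsRoot
    rcases hk with ⟨h, rfl⟩ | ⟨h, rfl⟩ <;> interval_cases n <;> decide +kernel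
  · rcases hk with ⟨h, rfl⟩ | ⟨h, rfl⟩ <;> interval_cases n <;> decide +kernel
  · refine ⟨fun j => if (j : ℕ) = 0 then n + 3 else n + 1 - j, ⟨?_, ?_⟩, ?_⟩
    · rw [form_toVec, Int.cast_lt_zero]
      interval_cases n <;> decide +kernel
    · simp only [toVec, Int.cast_pos]
      simp
      omega
    · rcases hk with ⟨h, rfl⟩ | ⟨h, rfl⟩ <;> interval_cases n <;> decide +kernel
  · obtain ⟨h1, h2⟩ := hle (p := (· < 0)) hx
    exact form_root_ne_zero hn hn' h1 h2 he
  · obtain ⟨h1, h2⟩ := hle (p := (· ≤ 0)) hx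
    exact forward_of_inCell hn' (inCell_pad hn hn' h1 h2) hx0

/-! ### The Coxeter diagram -/

/-- A Gram matrix entry `c` of two vectors of squares `a`, `b` belongs to the weight `w`; the
conditions say that `c / √(a b) = -cos (π / w)` in terms of squares. -/
def MatchesWeight (w : ℕ) (a b c : ℤ) : Prop :=
  (w = 1 ∧ a = b ∧ c = a) ∨ (w = 2 ∧ c = 0) ∨ (w = 3 ∧ c < 0 ∧ a * b = 4 * c * c) ∨
    (w = 4 ∧ c < 0 ∧ a * b = 2 * c * c) ∨ (w = 6 ∧ c < 0 ∧ 3 * (a * b) = 4 * c * c) ∨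
    (w = 0 ∧ c < 0 ∧ a * b = c * c)

lemma MatchesWeight.div_sqrt {w : ℕ} {a b c : ℤ} (h : MatchesWeight w a b c) (ha : 0 < a) :
    (c : ℝ) / √((a : ℝ) * b) = gramEntry w := by
  have haR : (0 : ℝ) < a := Int.cast_pos.2 ha
  -- `√(a b) = r |c|` once `a b = r² c²`
  have key : ∀ r : ℝ, 0 < r → c < 0 → (a : ℝ) * b = r ^ 2 * (c : ℝ) ^ 2 →
      (c : ℝ) / √((a : ℝ) * b) = -r⁻¹ := by
    intro r hr hc hab
    have hcR : (c : ℝ) < 0 := Int.cast_lt_zero.2 hc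
    have : √((a : ℝ) * b) = r * -c := by
      rw [Real.sqrt_eq_iff_mul_self_eq_of_pos (mul_pos hr (by linarith)), hab]
      ring
    rw [this]
    have := hcR.ne
    field_simp
  rcases h with ⟨rfl, rfl, rfl⟩ | ⟨rfl, rfl⟩ | ⟨rfl, hc, hab⟩ | ⟨rfl, hc, hab⟩ | ⟨rfl, hc, hab⟩ |
    ⟨rfl, hc, hab⟩
  · rw [Real.sqrt_mul_self haR.le, div_self haR.ne']
    simp [gramEntry]
  · simp [gramEntry]
  · have hab' : (a : ℝ) * b = 4 * c * c := by exact_mod_cast hab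
    rw [key 2 (by norm_num) hc (by rw [hab']; ring)]
    simp [gramEntry]
  · have hab' : (a : ℝ) * b = 2 * c * c := by exact_mod_cast hab
    rw [key (√2) (by positivity) hc (by rw [hab', Real.sq_sqrt (by norm_num)]; ring)]
    have h2 : (√2 : ℝ) ^ 2 = 2 := Real.sq_sqrt (by norm_num)
    simp only [gramEntry]
    norm_num
    field_simp
    linarith
  · have hab' : 3 * ((a : ℝ) * b) = 4 * c * c := by exact_mod_cast hab
    have h3 : (√3 : ℝ) ^ 2 = 3 := Real.sq_sqrt (by norm_num)
    rw [key (2 / √3) (by positivity) hc (by rw [div_pow, h3]; linarith)]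
    simp only [gramEntry]
    norm_num
  · have hab' : (a : ℝ) * b = c * c := by exact_mod_cast hab
    rw [key 1 one_pos hc (by rw [hab']; ring)]
    simp [gramEntry]

lemma matchesWeight_simpleRoot {k : ℕ} (hn : 2 ≤ n) (hn' : n ≤ 8)
    (hk : n ≤ 3 ∧ k = n + 1 ∨ 4 ≤ n ∧ k = n + 2) : ∀ i j : Fin k,
    MatchesWeight (diagram n i j) (iform (simpleRoot n i) (simpleRoot n i))
      (iform (simpleRoot n j) (simpleRoot n j)) (iform (simpleRoot n i) (simpleRoot n j)) := by
  unfold MatchesWeight diagram edgeWeight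
  rcases hk with ⟨h, rfl⟩ | ⟨h, rfl⟩ <;> interval_cases n <;> decide +kernel

/-- Every fundamental polyhedron is an image of the standard cell and has the diagram `D_n`. -/
lemma exists_hasCoxeterDiagram {k : ℕ} (hn : 2 ≤ n) (hn' : n ≤ 8)
    (hk : n ≤ 3 ∧ k = n + 1 ∨ 4 ≤ n ∧ k = n + 2) {P : Set (Vec n)}
    (hP : IsFundamentalPolyhedron n P) :
    ∃ γ ∈ integralAutomorphisms n,
      HasCoxeterDiagram P (fun i : Fin k => γ⁻¹ (toVec (simpleRoot n i))) (diagram n) ∧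
      P = hyperbolicSpace n ∩ SimpleSystem.closedCell (fun i : Fin k => simpleRoot n i) γ ∧
      closure P = SimpleSystem.closedCell (fun i : Fin k => simpleRoot n i) γ := by
  have hα := simpleSystem hn hn' hk
  obtain ⟨γ, hγ, h1, h2, h3⟩ := hα.exists_eq_cell hP
  refine ⟨γ, hγ, ⟨h1, fun i j => ?_⟩, h2, h3⟩
  simp only [(inv_mem hγ).1, form_toVec]
  have hpos := (hα.isRoot i).form_pos
  rw [form_toVec] at hpos
  exact (matchesWeight_simpleRoot hn hn' hk i j).div_sqrt (by exact_mod_cast hpos)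

/-! ### Projective maps and face lattices -/

section Projective

variable {E F : Type} [AddCommGroup E] [Module ℝ E] [TopologicalSpace E] [AddCommGroup F]
  [Module ℝ F] [TopologicalSpace F] [IsTopologicalAddGroup F] [ContinuousSMul ℝ F] [T2Space F]
  [FiniteDimensional ℝ F]

/-- Faces pull back under a projective map `y ↦ S y / h (S y)`: if `F` is the face of `A` where `l`
attains its maximum `M`, then its preimage is the face where the functional `(l - M h) ∘ S`, which
is nonpositive on `B`, vanishes. -/
lemma isExposed_preimage {A : Set E} {B : Set F} {S : F →ₗ[ℝ] E} {h : E →ₗ[ℝ] ℝ}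
    (hpos : ∀ y ∈ B, 0 < h (S y)) (hmem : ∀ y ∈ B, (h (S y))⁻¹ • S y ∈ A) {G : Set E}
    (hG : IsExposed ℝ A G) : IsExposed ℝ B {y | y ∈ B ∧ (h (S y))⁻¹ • S y ∈ G} := by
  rintro ⟨y₀, hy₀, hy₀G⟩
  obtain ⟨l, rfl⟩ := hG ⟨_, hy₀G⟩
  set M := l ((h (S y₀))⁻¹ • S y₀) with hM
  have key : ∀ y ∈ B, l (S y) - M * h (S y) = h (S y) * (l ((h (S y))⁻¹ • S y) - M) := by
    intro y hy
    have := (hpos y hy).ne'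
    rw [map_smul, smul_eq_mul]
    field_simp
  refine ⟨LinearMap.toContinuousLinearMap (l.toLinearMap.comp S - M • h.comp S), ?_⟩
  have happ : ∀ y, LinearMap.toContinuousLinearMap (l.toLinearMap.comp S - M • h.comp S) y =
      l (S y) - M * h (S y) := fun y => by simp
  ext y
  simp only [happ]
  constructor
  · rintro ⟨hy, -, hymax⟩
    refine ⟨hy, fun z hz => ?_⟩
    have h1 : l ((h (S z))⁻¹ • S z) ≤ M := hy₀G.2 _ (hmem z hz)
    have h2 : M ≤ l ((h (S y))⁻¹ • S y) := hymax _ (hmem y₀ hy₀)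
    rw [key z hz, key y hy]
    exact (mul_nonpos_of_nonneg_of_nonpos (hpos z hz).le (by linarith)).trans
      (mul_nonneg (hpos y hy).le (by linarith))
  · rintro ⟨hy, hymax⟩
    refine ⟨hy, hmem y hy, fun z hz => ?_⟩
    have h1 := hymax y₀ hy₀
    rw [key y hy, key y₀ hy₀, ← hM, sub_self, mul_zero] at h1
    have h2 := nonneg_of_mul_nonneg_right h1 (hpos y hy)
    have h3 : l z ≤ M := hy₀G.2 z hz
    linarith

variable [IsTopologicalAddGroup E] [ContinuousSMul ℝ E] [T2Space E] [FiniteDimensional ℝ E]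

/-- Projectively equivalent convex sets are combinatorially equivalent. -/
lemma combEquiv_of_projective {A : Set E} {B : Set F} (T : E →ₗ[ℝ] F) (S : F →ₗ[ℝ] E)
    (hE : E →ₗ[ℝ] ℝ) (hF : F →ₗ[ℝ] ℝ) (hA : ∀ x ∈ A, hE x = 1) (hB : ∀ y ∈ B, hF y = 1)
    (hTpos : ∀ x ∈ A, 0 < hF (T x)) (hTmem : ∀ x ∈ A, (hF (T x))⁻¹ • T x ∈ B)
    (hSpos : ∀ y ∈ B, 0 < hE (S y)) (hSmem : ∀ y ∈ B, (hE (S y))⁻¹ • S y ∈ A)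
    (hST : ∀ x ∈ A, S (T x) = x) (hTS : ∀ y ∈ B, T (S y) = y) : CombEquiv A B := by
  have h1 : ∀ x ∈ A, (hE (S ((hF (T x))⁻¹ • T x)))⁻¹ • S ((hF (T x))⁻¹ • T x) = x := by
    intro x hx
    have := (hTpos x hx).ne'
    rw [map_smul, hST x hx, map_smul, hA x hx, smul_smul, smul_eq_mul, mul_one,
      inv_mul_cancel₀ (inv_ne_zero this), one_smul]
  have h2 : ∀ y ∈ B, (hF (T ((hE (S y))⁻¹ • S y)))⁻¹ • T ((hE (S y))⁻¹ • S y) = y := by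
    intro y hy
    have := (hSpos y hy).ne'
    rw [map_smul, hTS y hy, map_smul, hB y hy, smul_smul, smul_eq_mul, mul_one,
      inv_mul_cancel₀ (inv_ne_zero this), one_smul]
  refine ⟨Equiv.toOrderIso
    { toFun := fun G => ⟨_, isExposed_preimage hSpos hSmem G.2⟩
      invFun := fun G => ⟨_, isExposed_preimage hTpos hTmem G.2⟩
      left_inv := fun G => Subtype.ext ?_
      right_inv := fun G => Subtype.ext ?_ } ?_ ?_⟩
  · ext x
    constructor
    · rintro ⟨hx, -, hxG⟩
      rwa [h1 x hx] at hxG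
    · intro hxG
      have hx := G.2.subset hxG
      exact ⟨hx, hTmem x hx, by rwa [h1 x hx]⟩
  · ext y
    constructor
    · rintro ⟨hy, -, hyG⟩
      rwa [h2 y hy] at hyG
    · intro hyG
      have hy := G.2.subset hyG
      exact ⟨hy, hSmem y hy, by rwa [h2 y hy]⟩
  · intro G G' hGG' y hy
    exact ⟨hy.1, hGG' hy.2⟩
  · intro G G' hGG' y hy
    exact ⟨hy.1, hGG' hy.2⟩

end Projective

/-! ### The fundamental weights -/

/-- The vector with `k + 1` coordinates `1`, followed by zeros. These vectors are, up to factors,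
dual to the simple roots with index at most `n`. -/
def stepVec (n k : ℕ) : Vec n := fun j => if (j : ℕ) ≤ k then 1 else 0

lemma pad_stepVec {k : ℕ} (hk : k ≤ n) (i : ℕ) :
    pad (stepVec n k) i = if i ≤ k then 1 else 0 := by
  unfold pad stepVec
  split_ifs <;> first | rfl | omega

lemma form_stepVec (hn : 2 ≤ n) (hn' : n ≤ 8) {i k : ℕ} (hi : i ≤ n) (hk : k ≤ n) :
    form (toVec (simpleRoot n i)) (stepVec n k) =
      if i = k then (if i = 0 then -3 else -1) else 0 := by
  rw [form_simpleRoot hn hn' _ i hi]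
  simp only [pad_stepVec hk]
  split_ifs <;> first | omega | norm_num

/-- The simple roots with index at most `n` span. -/
lemma eq_zero_of_form_simpleRoot (hn : 2 ≤ n) (hn' : n ≤ 8) {x : Vec n}
    (h : ∀ i ≤ n, form (toVec (simpleRoot n i)) x = 0) : x = 0 := by
  have step : ∀ i ≤ n, pad x i = pad x (i + 1) := by
    intro i hi
    have := h i hi
    rw [form_simpleRoot hn hn' x i hi] at this
    split_ifs at this with h0
    · subst h0; linarith
    · linarith
  have hz : ∀ d ≤ n, pad x (n - d) = 0 := by
    intro d
    induction d with
    | zero => intro _; rw [Nat.sub_zero, step n le_rfl, pad_of_lt x (Nat.lt_succ_self n)]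
    | succ d ih =>
      intro hd
      rw [step _ (by omega), show n - (d + 1) + 1 = n - d by omega]
      exact ih (by omega)
  refine eq_of_pad fun i hi => ?_
  have := hz (n - i) (by omega)
  rw [show n - (n - i) = i by omega] at this
  rw [this]
  simp [pad]

lemma form_last_stepVec_three (hn : 4 ≤ n) (hn' : n ≤ 8) :
    form (toVec (simpleRoot n (n + 1))) (stepVec n 3) = 0 := by
  rw [form_simpleRoot_last hn hn']
  simp only [pad_stepVec (show 3 ≤ n by omega)]
  norm_num

lemma form_self_stepVec_three (hn : 3 ≤ n) (hn' : n ≤ 8) :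
    form (stepVec n 3) (stepVec n 3) = 0 := by
  rw [form_self_pad hn']
  simp only [pad_stepVec (show 3 ≤ n by omega)]
  norm_num

/-- The linear relation between the products with the simple roots, where the black one does not
occur. -/
lemma sum_form_simpleRoot (hn : 4 ≤ n) (hn' : n ≤ 8) (x : Vec n) :
    ∑ i : Fin 3, (if (i : ℕ) = 1 then 2 else 1) * form (toVec (simpleRoot n i)) x =
      ∑ j : Fin (n - 3 + 1), (if 1 ≤ (j : ℕ) ∧ (j : ℕ) + 4 ≤ n then 2 else 1) *
        form (toVec (simpleRoot n (j + 4))) x := by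
  rw [Fin.sum_univ_eq_sum_range
      (fun i => (if i = 1 then 2 else 1) * form (toVec (simpleRoot n i)) x),
    Fin.sum_univ_eq_sum_range (fun j => (if 1 ≤ j ∧ j + 4 ≤ n then 2 else 1) *
      form (toVec (simpleRoot n (j + 4))) x), Finset.sum_range_succ _ (n - 3),
    show n - 3 + 4 = n + 1 by omega, form_simpleRoot_last hn hn', if_neg (by omega)]
  have hlt : ∀ j ∈ Finset.range (n - 3), form (toVec (simpleRoot n (j + 4))) x =
      pad x (j + 4 + 1) - pad x (j + 4) := fun j hj => by
    rw [Finset.mem_range] at hj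
    rw [form_simpleRoot (by omega) hn' x _ (by omega), if_neg (by omega)]
  have h3 : ∀ i ∈ Finset.range 3, form (toVec (simpleRoot n i)) x =
      if i = 0 then 3 * (pad x 1 - pad x 0) else pad x (i + 1) - pad x i := fun i hi => by
    rw [Finset.mem_range] at hi
    rw [form_simpleRoot (by omega) hn' x _ (by omega)]
  have e1 : ∀ c : ℕ → ℝ, ∑ j ∈ Finset.range (n - 3),
      c j * form (toVec (simpleRoot n (j + 4))) x =
      ∑ j ∈ Finset.range (n - 3), c j * (pad x (j + 4 + 1) - pad x (j + 4)) := fun c =>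
    Finset.sum_congr rfl fun j hj => by rw [hlt j hj]
  have e2 : ∀ c : ℕ → ℝ, ∑ i ∈ Finset.range 3, c i * form (toVec (simpleRoot n i)) x =
      ∑ i ∈ Finset.range 3,
        c i * (if i = 0 then 3 * (pad x 1 - pad x 0) else pad x (i + 1) - pad x i) := fun c =>
    Finset.sum_congr rfl fun i hi => by rw [h3 i hi]
  rw [e1 fun j => if 1 ≤ j ∧ j + 4 ≤ n then 2 else 1, e2 fun i => if i = 1 then 2 else 1]
  have hz := pad_of_lt x (Nat.lt_succ_self n)
  interval_cases n <;> simp [Finset.sum_range_succ] at hz ⊢ <;> linarith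

/-! ### Simplices -/

open SimpleSystem

lemma convex_closedCell {ι : Type} (α : ι → Fin (n + 1) → ℤ) (γ : Vec n ≃ₗ[ℝ] Vec n) :
    Convex ℝ (closedCell α γ) := by
  rintro x ⟨hx, hx'⟩ y ⟨hy, hy'⟩ s t hs ht hst
  refine ⟨by simp [hx, hy, hst], fun i => ?_⟩
  rw [map_add, map_smul, map_smul, form_add_right, form_smul_right, form_smul_right]
  have h1 := mul_nonpos_of_nonneg_of_nonpos hs (hx' i)
  have h2 := mul_nonpos_of_nonneg_of_nonpos ht (hy' i)
  linarith

lemma apply_inv_apply (γ : Vec n ≃ₗ[ℝ] Vec n) (x : Vec n) : γ (γ⁻¹ x) = x :=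
  LinearEquiv.apply_symm_apply γ x

lemma stepVec_ne_zero (k : ℕ) : stepVec n k ≠ 0 := fun h => by
  have := congrFun h 0
  simp [stepVec] at this

/-- A simple system with as many roots as the dimension of the space bounds a simplex. -/
lemma isSimplex_of_closure_eq (hn : 2 ≤ n) (hn3 : n ≤ 3) {γ : Vec n ≃ₗ[ℝ] Vec n}
    (hγ : γ ∈ integralAutomorphisms n) {P : Set (Vec n)}
    (hP : closure P = closedCell (fun i : Fin (n + 1) => simpleRoot n i) γ) : IsSimplex P := by
  have hn8 : n ≤ 8 := by omega
  have hα : SimpleSystem fun i : Fin (n + 1) => simpleRoot n i :=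
    simpleSystem hn hn8 (Or.inl ⟨hn3, rfl⟩)
  have hstep : ∀ i k : Fin (n + 1), form (toVec (simpleRoot n i)) (stepVec n k) =
      if i = k then (if (i : ℕ) = 0 then -3 else -1) else 0 := fun i k => by
    rw [form_stepVec hn hn8 (by omega) (by omega)]
    simp only [Fin.ext_iff]
  have hw0 : ∀ k : Fin (n + 1), 0 < (γ⁻¹ (stepVec n k)) 0 := fun k =>
    (hα.forward_of_mem hγ (fun i => by
      rw [apply_inv_apply, hstep]; split_ifs <;> norm_num)
      (by simpa using stepVec_ne_zero (n := n) k)).2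
  set v : Fin (n + 1) → Vec n := fun k => ((γ⁻¹ (stepVec n k)) 0)⁻¹ • γ⁻¹ (stepVec n k) with hv
  have hvform : ∀ i k : Fin (n + 1), form (toVec (simpleRoot n i)) (γ (v k)) =
      ((γ⁻¹ (stepVec n k)) 0)⁻¹ * if i = k then (if (i : ℕ) = 0 then -3 else -1) else 0 := by
    intro i k
    rw [hv, map_smul, form_smul_right, apply_inv_apply, hstep]
  have hvoff : ∀ i k : Fin (n + 1), i ≠ k → form (toVec (simpleRoot n i)) (γ (v k)) = 0 := by
    intro i k hik
    rw [hvform, if_neg hik, mul_zero]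
  have hvdiag : ∀ i : Fin (n + 1), form (toVec (simpleRoot n i)) (γ (v i)) < 0 := fun i => by
    rw [hvform, if_pos rfl]
    exact mul_neg_of_pos_of_neg (inv_pos.2 (hw0 i)) (by split_ifs <;> norm_num)
  have hvsum : ∀ (c : Fin (n + 1) → ℝ) (i : Fin (n + 1)),
      form (toVec (simpleRoot n i)) (γ (∑ k, c k • v k)) =
        c i * form (toVec (simpleRoot n i)) (γ (v i)) := by
    intro c i
    rw [map_sum, ← formL_apply, map_sum, Finset.sum_eq_single i]
    · rw [map_smul, map_smul, formL_apply, smul_eq_mul]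
    · intro k _ hk
      rw [map_smul, map_smul, formL_apply, hvoff i k hk.symm, smul_zero]
    · simp
  have hvQ : ∀ k, v k ∈ closedCell (fun i : Fin (n + 1) => simpleRoot n i) γ := by
    refine fun k => ⟨inv_mul_cancel₀ (hw0 k).ne', fun i => ?_⟩
    by_cases hik : i = k
    · subst hik; exact (hvdiag i).le
    · exact (hvoff i k hik).le
  refine ⟨v, ?_, ?_⟩
  · have hlin : LinearIndependent ℝ v := by
      rw [Fintype.linearIndependent_iff]
      intro c hc i
      have := hvsum c i
      rw [hc, map_zero, form_zero_right] at this
      exact (mul_eq_zero.1 this.symm).resolve_right (hvdiag i).ne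
    exact hlin.affineIndependent
  · rw [hP]
    refine Set.Subset.antisymm (fun x hx => ?_)
      (convexHull_min (Set.range_subset_iff.2 hvQ) (convex_closedCell _ _))
    set c : Fin (n + 1) → ℝ := fun i =>
      form (toVec (simpleRoot n i)) (γ x) / form (toVec (simpleRoot n i)) (γ (v i)) with hc
    have hxc : x = ∑ k, c k • v k := by
      rw [← sub_eq_zero, ← γ.map_eq_zero_iff]
      refine eq_zero_of_form_simpleRoot hn hn8 fun i hi => ?_
      have := hvsum c ⟨i, by omega⟩
      have hne := (hvdiag ⟨i, by omega⟩).ne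
      rw [hc, div_mul_cancel₀ _ hne] at this
      rw [map_sub, form_sub_right, sub_eq_zero]
      exact this.symm
    have hsum : ∑ k, c k = 1 := by
      have := congrFun hxc 0
      rw [hx.1, Finset.sum_apply] at this
      simpa [(hvQ _).1] using this.symm
    rw [hxc]
    exact (convex_convexHull ℝ _).sum_mem
      (fun i _ => div_nonneg_of_nonpos (hx.2 i) (hvdiag i).le) hsum
      fun i _ => subset_convexHull ℝ _ ⟨i, rfl⟩

/-! ### The ideal vertex -/

/-- The ideal point with representative `γ⁻¹ (1, 1, 1, 1, 0, …)`. -/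
noncomputable def apex (γ : Vec n ≃ₗ[ℝ] Vec n) : Vec n :=
  ((γ⁻¹ (stepVec n 3)) 0)⁻¹ • γ⁻¹ (stepVec n 3)

section Apex

variable {γ : Vec n ≃ₗ[ℝ] Vec n}

lemma apex_zero (hn : 3 ≤ n) (hn' : n ≤ 8) (hγ : γ ∈ integralAutomorphisms n) :
    0 < (γ⁻¹ (stepVec n 3)) 0 :=
  forward_apply (inv_mem hγ) (form_self_stepVec_three hn hn').le (by simp [stepVec])

lemma eq_apex {x : Vec n} (hx : x 0 = 1) {c : ℝ} (h : γ x = c • stepVec n 3) : x = apex γ := by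
  have h1 : x = c • γ⁻¹ (stepVec n 3) := by
    rw [← map_smul, ← h]
    exact (LinearEquiv.symm_apply_apply γ x).symm
  have h2 : c * (γ⁻¹ (stepVec n 3)) 0 = 1 := by
    rw [h1] at hx
    simpa using hx
  rw [apex, ← eq_inv_of_mul_eq_one_left h2]
  exact h1

lemma form_apex (hn : 3 ≤ n) (hn' : n ≤ 8) (hγ : γ ∈ integralAutomorphisms n) :
    form (apex γ) (apex γ) = 0 := by
  rw [apex, form_smul_left, form_smul_right, (inv_mem hγ).1, form_self_stepVec_three hn hn']
  ring

variable {k : ℕ}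

/-- The walls through the apex are those with index different from `3`. -/
lemma form_simpleRoot_apex (hn : 3 ≤ n) (hn' : n ≤ 8) (hγ : γ ∈ integralAutomorphisms n)
    (hk : n ≤ 3 ∧ k = n + 1 ∨ 4 ≤ n ∧ k = n + 2) (i : Fin k) :
    ((i : ℕ) ≠ 3 → form (toVec (simpleRoot n i)) (γ (apex γ)) = 0) ∧
      ((i : ℕ) = 3 → form (toVec (simpleRoot n i)) (γ (apex γ)) < 0) := by
  rw [apex, map_smul, apply_inv_apply, form_smul_right]
  have hpos := inv_pos.2 (apex_zero hn hn' hγ)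
  constructor
  · intro hi
    by_cases hin : (i : ℕ) ≤ n
    · rw [form_stepVec (by omega) hn' hin hn, if_neg hi, mul_zero]
    · rw [show (i : ℕ) = n + 1 by omega, form_last_stepVec_three (by omega) hn', mul_zero]
  · intro hi
    rw [form_stepVec (by omega) hn' (by omega) hn, if_pos hi, if_neg (by omega)]
    linarith

lemma apex_mem (hn : 3 ≤ n) (hn' : n ≤ 8) (hγ : γ ∈ integralAutomorphisms n)
    (hk : n ≤ 3 ∧ k = n + 1 ∨ 4 ≤ n ∧ k = n + 2) :
    apex γ ∈ closedCell (fun i : Fin k => simpleRoot n i) γ := by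
  refine ⟨inv_mul_cancel₀ (apex_zero hn hn' hγ).ne', fun i => ?_⟩
  obtain ⟨h1, h2⟩ := form_simpleRoot_apex hn hn' hγ hk i
  by_cases hi : (i : ℕ) = 3
  · exact (h2 hi).le
  · exact (h1 hi).le

lemma inCell_of_mem (hn : 2 ≤ n) (hn' : n ≤ 8)
    (hk : n ≤ 3 ∧ k = n + 1 ∨ 4 ≤ n ∧ k = n + 2) {x : Vec n}
    (hx : ∀ i : Fin k, form (toVec (simpleRoot n i)) x ≤ 0) : InCell (pad x) :=
  inCell_pad hn hn' (fun i hi => hx ⟨i, by omega⟩) fun h4 => hx ⟨n + 1, by omega⟩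

lemma ne_zero_of_apply_zero {x : Vec n} (hx : x 0 = 1) : x ≠ 0 := by
  rintro rfl
  simp at hx

/-- An isotropic point of the closed cell is the apex; in particular there is none for `n = 2`. -/
lemma eq_apex_of_isotropic (hn : 2 ≤ n) (hn' : n ≤ 8) (hγ : γ ∈ integralAutomorphisms n)
    (hk : n ≤ 3 ∧ k = n + 1 ∨ 4 ≤ n ∧ k = n + 2) {x : Vec n}
    (hx : x ∈ closedCell (fun i : Fin k => simpleRoot n i) γ) (h0 : form x x = 0) :
    3 ≤ n ∧ x = apex γ := by
  have hc := inCell_of_mem hn hn' hk hx.2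
  have hx0 : γ x ≠ 0 := by simpa using ne_zero_of_apply_zero hx.1
  have hpos := (forward_of_inCell hn' hc hx0).2
  rw [← hγ.1, form_self_pad hn'] at h0
  obtain ⟨h1, h2, h3, h4, h5, h6, h7, h8⟩ := hc.eq_of_isotropic hpos (by linarith)
  have hn3 : 3 ≤ n := by
    by_contra! hlt
    rw [pad_of_lt _ hlt] at h3
    rw [← pad_zero (γ x), ← h3] at hpos
    exact lt_irrefl _ hpos
  refine ⟨hn3, eq_apex hx.1 (c := (γ x) 0) (eq_of_pad fun i hi => ?_)⟩
  have hsmul : pad ((γ x) 0 • stepVec n 3) i = pad (γ x) 0 * pad (stepVec n 3) i := by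
    rw [pad_zero]
    unfold pad
    split_ifs
    · rfl
    · rw [mul_zero]
  rw [hsmul, pad_stepVec hn3]
  have hi8 : i ≤ 8 := hi.trans hn'
  interval_cases i <;> simp <;> assumption

lemma idealVertices_eq (hn : 3 ≤ n) (hn' : n ≤ 8) (hγ : γ ∈ integralAutomorphisms n)
    (hk : n ≤ 3 ∧ k = n + 1 ∨ 4 ≤ n ∧ k = n + 2) {P : Set (Vec n)}
    (hP : closure P = closedCell (fun i : Fin k => simpleRoot n i) γ) :
    idealVertices P = {apex γ} := by
  ext x
  simp only [idealVertices, hP, Set.mem_singleton_iff]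
  constructor
  · rintro ⟨hx, h0⟩
    exact (eq_apex_of_isotropic (by omega) hn' hγ hk hx.1 h0).2
  · rintro rfl
    refine ⟨⟨apex_mem hn hn' hγ hk, fun y hy z hz hyz => ?_⟩, form_apex hn hn' hγ⟩
    -- `y` lies on every wall through the apex
    obtain ⟨s, t, hs, ht, hst, h⟩ := hyz
    have hy0 : ∀ i : Fin k, (i : ℕ) ≠ 3 → form (toVec (simpleRoot n i)) (γ y) = 0 := by
      intro i hi
      have h1 := (form_simpleRoot_apex hn hn' hγ hk i).1 hi
      rw [← h, map_add, map_smul, map_smul, form_add_right, form_smul_right, form_smul_right] at h1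
      have h2 := hy.2 i
      have h3 := mul_nonpos_of_nonneg_of_nonpos ht.le (hz.2 i)
      refine le_antisymm h2 ?_
      by_contra! hlt
      have := mul_neg_of_pos_of_neg hs hlt
      linarith
    refine eq_apex hy.1 (c := -form (toVec (simpleRoot n 3)) (γ y)) ?_
    rw [← sub_eq_zero]
    refine eq_zero_of_form_simpleRoot (by omega) hn' fun i hi => ?_
    rw [form_sub_right, form_smul_right, form_stepVec (by omega) hn' hi hn]
    by_cases hi3 : i = 3
    · subst hi3; norm_num
    · rw [if_neg hi3, mul_zero, sub_zero]
      exact hy0 ⟨i, by omega⟩ hi3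

lemma not_isCompact (hn : 3 ≤ n) (hn' : n ≤ 8) (hγ : γ ∈ integralAutomorphisms n)
    (hk : n ≤ 3 ∧ k = n + 1 ∨ 4 ≤ n ∧ k = n + 2) {P : Set (Vec n)}
    (hPH : P ⊆ hyperbolicSpace n)
    (hP : closure P = closedCell (fun i : Fin k => simpleRoot n i) γ) : ¬ IsCompact P := by
  intro hc
  have h1 := apex_mem hn hn' hγ hk
  rw [← hP, hc.isClosed.closure_eq] at h1
  have h2 := (hPH h1).1.1
  rw [form_apex hn hn' hγ] at h2
  exact lt_irrefl _ h2

/-! ### The pyramid -/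

lemma isPyramid (hn : 4 ≤ n) (hn' : n ≤ 8) (hγ : γ ∈ integralAutomorphisms n) {P : Set (Vec n)}
    (hP : closure P = closedCell (fun i : Fin (n + 2) => simpleRoot n i) γ) :
    IsPyramid (closure P) (faceIn P (γ⁻¹ (toVec (simpleRoot n 3)))) (apex γ) := by
  have hk : n ≤ 3 ∧ n + 2 = n + 1 ∨ 4 ≤ n ∧ n + 2 = n + 2 := Or.inr ⟨hn, rfl⟩
  have hα := simpleSystem (by omega) hn' hk
  have hapex := form_simpleRoot_apex (by omega) hn' hγ hk
  have hneg := (hapex ⟨3, by omega⟩).2 rfl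
  simp only at hneg
  have hface : ∀ x, form (γ⁻¹ (toVec (simpleRoot n 3))) x =
      form (toVec (simpleRoot n 3)) (γ x) := fun x => form_inv_left hγ _ _
  constructor
  · intro hmem
    have hsub : affineSpan ℝ (faceIn P (γ⁻¹ (toVec (simpleRoot n 3)))) ≤
        (LinearMap.ker (formL (γ⁻¹ (toVec (simpleRoot n 3))))).toAffineSubspace := by
      rw [affineSpan_le]
      rintro x ⟨-, hx⟩
      exact hx
    have : form (γ⁻¹ (toVec (simpleRoot n 3))) (apex γ) = 0 := hsub hmem
    rw [hface] at this
    exact hneg.ne this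
  · have hB : faceIn P (γ⁻¹ (toVec (simpleRoot n 3))) ⊆ closure P := fun x hx => hx.1
    have hconv : Convex ℝ (closure P) := by rw [hP]; exact convex_closedCell _ _
    have hmem : apex γ ∈ closure P := by rw [hP]; exact apex_mem (by omega) hn' hγ hk
    refine Set.Subset.antisymm (fun x hx => ?_)
      (convexHull_min (Set.insert_subset hmem hB) hconv)
    rw [hP] at hx
    -- project `x` from the apex to the base
    set s := form (toVec (simpleRoot n 3)) (γ x) / form (toVec (simpleRoot n 3)) (γ (apex γ))
      with hs
    have hs0 : 0 ≤ s := div_nonneg_of_nonpos (hx.2 ⟨3, by omega⟩) hneg.le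
    set z := x - s • apex γ with hz
    have hzform : ∀ i : Fin (n + 2), form (toVec (simpleRoot n i)) (γ z) =
        form (toVec (simpleRoot n i)) (γ x) - s * form (toVec (simpleRoot n i)) (γ (apex γ)) := by
      intro i
      rw [hz, map_sub, map_smul, form_sub_right, form_smul_right]
    have hz3 : form (toVec (simpleRoot n 3)) (γ z) = 0 := by
      have := hzform ⟨3, by omega⟩
      simp only at this
      rw [this, hs, div_mul_cancel₀ _ hneg.ne, sub_self]
    have hzcell : ∀ i : Fin (n + 2), form (toVec (simpleRoot n i)) (γ z) ≤ 0 := by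
      intro i
      by_cases hi : (i : ℕ) = 3
      · rw [hi]; exact hz3.le
      · rw [hzform, (hapex i).1 hi, mul_zero, sub_zero]
        exact hx.2 i
    have hx0 : z 0 = 1 - s := by
      simp [hz, hx.1, (apex_mem (by omega) hn' hγ hk).1]
    have hxz : x = s • apex γ + z := by simp [hz]
    have ha : apex γ ∈ convexHull ℝ (insert (apex γ)
        (faceIn P (γ⁻¹ (toVec (simpleRoot n 3))))) := subset_convexHull ℝ _ (Set.mem_insert _ _)
    by_cases hz0 : z = 0
    · have : s = 1 := by rw [hz0] at hx0; simp at hx0; linarith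
      rw [hxz, hz0, this, one_smul, add_zero]
      exact ha
    · have hpos := (hα.forward_of_mem hγ hzcell hz0).2
      have hb : (z 0)⁻¹ • z ∈ faceIn P (γ⁻¹ (toVec (simpleRoot n 3))) := by
        refine ⟨?_, by rw [hface, map_smul, form_smul_right, hz3, mul_zero]⟩
        rw [hP]
        refine ⟨by simp [hpos.ne'], fun i => ?_⟩
        rw [map_smul, form_smul_right]
        exact mul_nonpos_of_nonneg_of_nonpos (inv_pos.2 hpos).le (hzcell i)
      have hx' : x = s • apex γ + z 0 • ((z 0)⁻¹ • z) := by
        rw [smul_smul, mul_inv_cancel₀ hpos.ne', one_smul]; exact hxz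
      rw [hx']
      exact convex_convexHull ℝ _ ha (subset_convexHull ℝ _ (Set.mem_insert_of_mem _ hb)) hs0
        hpos.le (by rw [hx0]; ring)

end Apex

/-! ### The base of the pyramid -/

/-- The coefficients of a point of the base with respect to the vectors `stepVec n k`, `k ≤ n`,
`k ≠ 3`, in terms of the barycentric coordinates of the two simplices. -/
noncomputable def baseCoeff (n : ℕ) (y : (Fin 3 → ℝ) × (Fin (n - 3 + 1) → ℝ)) (k : ℕ) : ℝ :=
  if h : k < 3 then y.1 ⟨k, h⟩ / (if k = 0 then 3 else if k = 1 then 2 else 1)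
  else if h : 4 ≤ k ∧ k ≤ n then y.2 ⟨k - 4, by omega⟩ / (if k = 4 then 1 else 2)
  else 0

/-- The linear map from the ambient space of the product of simplices to the space of the cone over
the base. -/
noncomputable def fromProduct (n : ℕ) : (Fin 3 → ℝ) × (Fin (n - 3 + 1) → ℝ) →ₗ[ℝ] Vec n where
  toFun y := ∑ k ∈ Finset.range (n + 1), baseCoeff n y k • stepVec n k
  map_add' y z := by
    rw [← Finset.sum_add_distrib]
    refine Finset.sum_congr rfl fun k _ => ?_
    rw [← add_smul]
    congr 1
    unfold baseCoeff
    split_ifs <;> simp [add_div]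
  map_smul' c y := by
    rw [Finset.smul_sum]
    refine Finset.sum_congr rfl fun k _ => ?_
    rw [RingHom.id_apply, smul_smul]
    congr 1
    unfold baseCoeff
    split_ifs <;> simp [mul_div_assoc]

lemma form_fromProduct (hn : 2 ≤ n) (hn' : n ≤ 8) (y : (Fin 3 → ℝ) × (Fin (n - 3 + 1) → ℝ)) {i : ℕ}
    (hi : i ≤ n) : form (toVec (simpleRoot n i)) (fromProduct n y) =
      (if i = 0 then -3 else -1) * baseCoeff n y i := by
  change form _ (∑ k ∈ Finset.range (n + 1), baseCoeff n y k • stepVec n k) = _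
  rw [← formL_apply, map_sum, Finset.sum_eq_single i]
  · rw [map_smul, formL_apply, form_stepVec hn hn' hi hi, if_pos rfl, smul_eq_mul, mul_comm]
  · intro k hk hki
    rw [map_smul, formL_apply, form_stepVec hn hn' hi (by simpa using hk), if_neg hki.symm,
      smul_zero]
  · intro h
    exact absurd (Finset.mem_range.2 (by omega)) h

/-- The linear map whose coordinates are the products with the simple roots different from the
black one, scaled such that the linear relation between them says that the coordinate sums of both
components agree. -/
noncomputable def toProduct (n : ℕ) : Vec n →ₗ[ℝ] (Fin 3 → ℝ) × (Fin (n - 3 + 1) → ℝ) :=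
  (LinearMap.pi fun i : Fin 3 =>
    (-(if (i : ℕ) = 1 then 2 else 1 : ℝ)) • formL (toVec (simpleRoot n i))).prod
  (LinearMap.pi fun j : Fin (n - 3 + 1) =>
    (-(if 1 ≤ (j : ℕ) ∧ (j : ℕ) + 4 ≤ n then 2 else 1 : ℝ)) •
      formL (toVec (simpleRoot n (j + 4))))

lemma toProduct_fst (x : Vec n) (i : Fin 3) : (toProduct n x).1 i =
    -((if (i : ℕ) = 1 then 2 else 1) * form (toVec (simpleRoot n i)) x) := by
  simp [toProduct, formL_apply]

lemma toProduct_snd (x : Vec n) (j : Fin (n - 3 + 1)) : (toProduct n x).2 j =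
    -((if 1 ≤ (j : ℕ) ∧ (j : ℕ) + 4 ≤ n then 2 else 1) *
      form (toVec (simpleRoot n (j + 4))) x) := by
  simp [toProduct, formL_apply]

/-- The sum of the barycentric coordinates of the first simplex. -/
noncomputable def sumFst (n : ℕ) : (Fin 3 → ℝ) × (Fin (n - 3 + 1) → ℝ) →ₗ[ℝ] ℝ :=
  (∑ i : Fin 3, LinearMap.proj i) ∘ₗ LinearMap.fst ℝ _ _

lemma sumFst_apply (y : (Fin 3 → ℝ) × (Fin (n - 3 + 1) → ℝ)) : sumFst n y = ∑ i, y.1 i := by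
  simp [sumFst]

lemma sum_toProduct (hn : 4 ≤ n) (hn' : n ≤ 8) (x : Vec n) :
    ∑ j, (toProduct n x).2 j = ∑ i, (toProduct n x).1 i := by
  simp only [toProduct_fst, toProduct_snd, Finset.sum_neg_distrib]
  rw [sum_form_simpleRoot hn hn']

lemma fromProduct_toProduct (hn : 4 ≤ n) (hn' : n ≤ 8) {x : Vec n}
    (hx : form (toVec (simpleRoot n 3)) x = 0) : fromProduct n (toProduct n x) = x := by
  rw [← sub_eq_zero]
  refine eq_zero_of_form_simpleRoot (by omega) hn' fun i hi => ?_
  rw [form_sub_right, form_fromProduct (by omega) hn' _ hi, sub_eq_zero]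
  unfold baseCoeff
  by_cases h3 : i < 3
  · rw [dif_pos h3, toProduct_fst]
    interval_cases i <;> norm_num <;> ring
  · rw [dif_neg h3]
    by_cases h4 : 4 ≤ i ∧ i ≤ n
    · rw [dif_pos h4, toProduct_snd, if_neg (by omega)]
      simp only [show i - 4 + 4 = i by omega]
      by_cases h : i = 4
      · rw [if_pos h, if_neg (by omega)]; ring
      · rw [if_neg h, if_pos (by omega)]; ring
    · rw [dif_neg h4, mul_zero, show i = 3 by omega, hx]

lemma toProduct_fromProduct (hn : 4 ≤ n) (hn' : n ≤ 8) {y : (Fin 3 → ℝ) × (Fin (n - 3 + 1) → ℝ)}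
    (hy : ∑ j, y.2 j = ∑ i, y.1 i) : toProduct n (fromProduct n y) = y := by
  have h1 : ∀ i, (toProduct n (fromProduct n y)).1 i = y.1 i := by
    intro i
    rw [toProduct_fst, form_fromProduct (by omega) hn' _ (by omega), baseCoeff, dif_pos i.2]
    fin_cases i <;> norm_num <;> ring
  have h2 : ∀ j : Fin (n - 3 + 1), (j : ℕ) + 4 ≤ n →
      (toProduct n (fromProduct n y)).2 j = y.2 j := by
    intro j hj
    rw [toProduct_snd, form_fromProduct (by omega) hn' _ hj, baseCoeff, dif_neg (by omega),
      dif_pos (by omega), if_neg (show (j : ℕ) + 4 ≠ 0 by omega)]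
    simp only [Nat.add_sub_cancel, Fin.eta]
    by_cases h : (j : ℕ) = 0
    · rw [if_neg (by omega), if_pos (by omega)]; ring
    · rw [if_pos (by omega), if_neg (by omega)]; ring
  -- the last coordinate is determined by the relation
  have h3 : (toProduct n (fromProduct n y)).2 (Fin.last _) = y.2 (Fin.last _) := by
    have hs := sum_toProduct hn hn' (fromProduct n y)
    rw [Finset.sum_congr rfl fun i _ => h1 i, ← hy, Fin.sum_univ_castSucc,
      Fin.sum_univ_castSucc (f := y.2),
      Finset.sum_congr rfl fun (j : Fin (n - 3)) _ => h2 j.castSucc (by simp; omega)] at hs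
    linarith
  refine Prod.ext (funext h1) (funext fun j => ?_)
  by_cases hj : (j : ℕ) + 4 ≤ n
  · exact h2 j hj
  · rw [show j = Fin.last _ from Fin.ext (by simp; omega)]
    exact h3

/-- The base is projectively equivalent to a product of two simplices. -/
lemma isProductOfTwoSimplices (hn : 4 ≤ n) (hn' : n ≤ 8) {γ : Vec n ≃ₗ[ℝ] Vec n}
    (hγ : γ ∈ integralAutomorphisms n) {P : Set (Vec n)}
    (hP : closure P = closedCell (fun i : Fin (n + 2) => simpleRoot n i) γ) :
    IsProductOfTwoSimplices (n - 1) (faceIn P (γ⁻¹ (toVec (simpleRoot n 3)))) := by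
  have hα : SimpleSystem fun i : Fin (n + 2) => simpleRoot n i :=
    simpleSystem (by omega) hn' (Or.inr ⟨hn, rfl⟩)
  have hface : ∀ x, x ∈ faceIn P (γ⁻¹ (toVec (simpleRoot n 3))) ↔
      (x 0 = 1 ∧ ∀ i : Fin (n + 2), form (toVec (simpleRoot n i)) (γ x) ≤ 0) ∧
        form (toVec (simpleRoot n 3)) (γ x) = 0 := by
    intro x
    unfold faceIn
    rw [hP, ← form_inv_left hγ]
    rfl
  have hnn : ∀ x : Vec n, (∀ i : Fin (n + 2), form (toVec (simpleRoot n i)) x ≤ 0) →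
      (∀ i, 0 ≤ (toProduct n x).1 i) ∧ ∀ j, 0 ≤ (toProduct n x).2 j := by
    intro x hx
    constructor
    · intro i
      rw [toProduct_fst, neg_nonneg]
      exact mul_nonpos_of_nonneg_of_nonpos (by split_ifs <;> norm_num) (hx ⟨i, by omega⟩)
    · intro j
      rw [toProduct_snd, neg_nonneg]
      exact mul_nonpos_of_nonneg_of_nonpos (by split_ifs <;> norm_num) (hx ⟨j + 4, by omega⟩)
  have hzero : ∀ y : (Fin 3 → ℝ) × (Fin (n - 3 + 1) → ℝ), (∀ i, 0 ≤ y.1 i) → (∀ j, 0 ≤ y.2 j) →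
      ∑ j, y.2 j = ∑ i, y.1 i → ∑ i, y.1 i = 0 → y = 0 := by
    intro y h1 h2 h3 h4
    rw [h4] at h3
    rw [Finset.sum_eq_zero_iff_of_nonneg fun i _ => h1 i] at h4
    rw [Finset.sum_eq_zero_iff_of_nonneg fun i _ => h2 i] at h3
    exact Prod.ext (funext fun i => h4 i (Finset.mem_univ i))
      (funext fun j => h3 j (Finset.mem_univ j))
  have hTpos : ∀ x ∈ faceIn P (γ⁻¹ (toVec (simpleRoot n 3))),
      0 < ∑ i, (toProduct n (γ x)).1 i := by
    intro x hx
    obtain ⟨⟨hx0, hx1⟩, hx2⟩ := (hface x).1 hx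
    obtain ⟨h1, h2⟩ := hnn _ hx1
    refine (Finset.sum_nonneg fun i _ => h1 i).lt_of_ne fun h => ?_
    have h3 := hzero _ h1 h2 (sum_toProduct hn hn' _) h.symm
    have h4 := fromProduct_toProduct hn hn' hx2
    rw [h3, map_zero] at h4
    exact ne_zero_of_apply_zero hx0 (by simpa using h4.symm)
  have hS : ∀ y ∈ stdSimplex ℝ (Fin 3) ×ˢ stdSimplex ℝ (Fin (n - 3 + 1)),
      toProduct n (fromProduct n y) = y ∧
      (∀ i : Fin (n + 2), form (toVec (simpleRoot n i)) (fromProduct n y) ≤ 0) ∧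
      form (toVec (simpleRoot n 3)) (fromProduct n y) = 0 := by
    rintro y ⟨⟨hy1, hy1'⟩, hy2, hy2'⟩
    have hTS := toProduct_fromProduct hn hn' (hy2'.trans hy1'.symm)
    have h3 : form (toVec (simpleRoot n 3)) (fromProduct n y) = 0 := by
      rw [form_fromProduct (by omega) hn' _ (by omega), baseCoeff, dif_neg (by omega),
        dif_neg (by omega), mul_zero]
    refine ⟨hTS, fun i => ?_, h3⟩
    rcases lt_trichotomy (i : ℕ) 3 with hi | hi | hi
    · have h := toProduct_fst (fromProduct n y) ⟨i, hi⟩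
      rw [hTS] at h
      have h0 := hy1 ⟨i, hi⟩
      rw [h] at h0
      simp only at h0
      split_ifs at h0 <;> linarith
    · rw [hi]; exact h3.le
    · have h := toProduct_snd (fromProduct n y) ⟨i - 4, by omega⟩
      rw [hTS] at h
      have h0 := hy2 ⟨i - 4, by omega⟩
      rw [h] at h0
      simp only [show (i : ℕ) - 4 + 4 = i by omega] at h0
      split_ifs at h0 <;> linarith
  have hSpos : ∀ y ∈ stdSimplex ℝ (Fin 3) ×ˢ stdSimplex ℝ (Fin (n - 3 + 1)),
      0 < (γ⁻¹ (fromProduct n y)) 0 := by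
    intro y hy
    obtain ⟨h1, h2, -⟩ := hS y hy
    refine (hα.forward_of_mem hγ (fun i => by rw [apply_inv_apply]; exact h2 i) ?_).2
    intro h0
    have hy0 : fromProduct n y = 0 := by simpa using h0
    rw [hy0, map_zero] at h1
    have := hy.1.2
    rw [← h1] at this
    simp at this
  refine ⟨2, n - 3, by norm_num, by omega, by omega, ?_⟩
  refine combEquiv_of_projective (toProduct n ∘ₗ γ.toLinearMap)
    ((γ⁻¹).toLinearMap ∘ₗ fromProduct n) (LinearMap.proj 0) (sumFst n)
    (fun x hx => ((hface x).1 hx).1.1) (fun y hy => ?_) (fun x hx => ?_) (fun x hx => ?_)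
    hSpos (fun y hy => ?_) (fun x hx => ?_) (fun y hy => ?_)
  · rw [sumFst_apply]; exact hy.1.2
  · rw [sumFst_apply]; exact hTpos x hx
  · obtain ⟨⟨hx0, hx1⟩, hx2⟩ := (hface x).1 hx
    obtain ⟨h1, h2⟩ := hnn _ hx1
    have hp := hTpos x hx
    rw [sumFst_apply]
    have hinv := (inv_pos.2 hp).le
    refine ⟨⟨fun i => mul_nonneg hinv (h1 i), ?_⟩, fun j => mul_nonneg hinv (h2 j), ?_⟩
    · change ∑ i, _ * (toProduct n (γ x)).1 i = 1
      rw [← Finset.mul_sum]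
      exact inv_mul_cancel₀ hp.ne'
    · change ∑ j, _ * (toProduct n (γ x)).2 j = 1
      rw [← Finset.mul_sum, sum_toProduct hn hn']
      exact inv_mul_cancel₀ hp.ne'
  · obtain ⟨-, h2, h3⟩ := hS y hy
    have hp := hSpos y hy
    rw [hface]
    change (((γ⁻¹ (fromProduct n y)) 0)⁻¹ * (γ⁻¹ (fromProduct n y)) 0 = 1 ∧
      ∀ i : Fin (n + 2), form (toVec (simpleRoot n i))
        (γ (((γ⁻¹ (fromProduct n y)) 0)⁻¹ • γ⁻¹ (fromProduct n y))) ≤ 0) ∧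
      form (toVec (simpleRoot n 3))
        (γ (((γ⁻¹ (fromProduct n y)) 0)⁻¹ • γ⁻¹ (fromProduct n y))) = 0
    rw [map_smul, apply_inv_apply]
    refine ⟨⟨inv_mul_cancel₀ hp.ne', fun i => ?_⟩, by rw [form_smul_right, h3, mul_zero]⟩
    rw [form_smul_right]
    exact mul_nonpos_of_nonneg_of_nonpos (inv_pos.2 hp).le (h2 i)
  · change γ⁻¹ (fromProduct n (toProduct n (γ x))) = x
    rw [fromProduct_toProduct hn hn' ((hface x).1 hx).2]
    exact LinearEquiv.symm_apply_apply γ x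
  · change toProduct n (γ (γ⁻¹ (fromProduct n y))) = y
    rw [apply_inv_apply]
    exact (hS y hy).1

/-- For `n = 2` the simplex has no ideal points, so it is compact. -/
lemma isCompact_of_isSimplex (hn : n = 2) {γ : Vec n ≃ₗ[ℝ] Vec n}
    (hγ : γ ∈ integralAutomorphisms n) {P : Set (Vec n)} (hs : IsSimplex P)
    (hPQ : P = hyperbolicSpace n ∩ closedCell (fun i : Fin (n + 1) => simpleRoot n i) γ)
    (hP : closure P = closedCell (fun i : Fin (n + 1) => simpleRoot n i) γ) : IsCompact P := by
  have hk : n ≤ 3 ∧ n + 1 = n + 1 ∨ 4 ≤ n ∧ n + 1 = n + 2 := Or.inl ⟨by omega, rfl⟩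
  have hα := simpleSystem (by omega) (by omega) hk
  have hcl : P = closure P := by
    rw [hP, hPQ, Set.inter_eq_right]
    intro x hx
    obtain ⟨h1, h2⟩ := hα.forward_of_mem hγ hx.2 (ne_zero_of_apply_zero hx.1)
    refine ⟨⟨h1.lt_of_ne fun h0 => ?_, h2⟩, hx.1⟩
    have := (eq_apex_of_isotropic (by omega) (by omega) hγ hk hx h0).1
    omega
  obtain ⟨v, -, hv⟩ := hs
  rw [hcl, hv]
  exact (Set.finite_range v).isCompact_convexHull ℝ

end LorentzThree

theorem mainTheorem2 :
    (∀ n : ℕ, 2 ≤ n → n ≤ 8 → ∃ P, LorentzThree.IsFundamentalPolyhedron n P) ∧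
    (∀ n : ℕ, n = 2 ∨ n = 3 →
      ∀ P : Set (LorentzThree.Vec n), LorentzThree.IsFundamentalPolyhedron n P →
        (∃ e : Fin (n + 1) → LorentzThree.Vec n,
          LorentzThree.HasCoxeterDiagram P e (LorentzThree.diagram n)) ∧
        LorentzThree.IsSimplex P ∧
        (n = 2 → IsCompact P) ∧ (n = 3 → ¬ IsCompact P)) ∧
    (∀ n : ℕ, ∀ hn : 4 ≤ n, n ≤ 8 →
      ∀ P : Set (LorentzThree.Vec n), LorentzThree.IsFundamentalPolyhedron n P →
        ¬ IsCompact P ∧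
        ∃ (e : Fin (n + 2) → LorentzThree.Vec n) (a : LorentzThree.Vec n),
          LorentzThree.HasCoxeterDiagram P e (LorentzThree.diagram n) ∧
          LorentzThree.IsPyramid (closure P)
            (LorentzThree.faceIn P (e ⟨3, Nat.lt_of_lt_of_le hn (Nat.le_add_right n 2)⟩)) a ∧
          LorentzThree.IsProductOfTwoSimplices (n - 1)
            (LorentzThree.faceIn P (e ⟨3, Nat.lt_of_lt_of_le hn (Nat.le_add_right n 2)⟩)) ∧
          LorentzThree.idealVertices P = {a}) := by
  open LorentzThree in
  refine ⟨fun n hn hn' => ?_, fun n hn P hP => ?_, fun n hn hn' P hP => ?_⟩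
  · rcases le_or_gt n 3 with h | h
    · exact (simpleSystem (k := n + 1) hn hn' (Or.inl ⟨h, rfl⟩)).exists_isFundamentalPolyhedron
    · exact (simpleSystem (k := n + 2) hn hn' (Or.inr ⟨h, rfl⟩)).exists_isFundamentalPolyhedron
  · have hk : n ≤ 3 ∧ n + 1 = n + 1 ∨ 4 ≤ n ∧ n + 1 = n + 2 := Or.inl ⟨by omega, rfl⟩
    obtain ⟨γ, hγ, hdiag, hPQ, hcl⟩ := exists_hasCoxeterDiagram (by omega) (by omega) hk hP
    have hs := isSimplex_of_closure_eq (by omega) (by omega) hγ hcl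
    exact ⟨⟨_, hdiag⟩, hs, fun h2 => isCompact_of_isSimplex h2 hγ hs hPQ hcl, fun h3 =>
      not_isCompact (by omega) (by omega) hγ hk (hPQ.trans_subset Set.inter_subset_left) hcl⟩
  · have hk : n ≤ 3 ∧ n + 2 = n + 1 ∨ 4 ≤ n ∧ n + 2 = n + 2 := Or.inr ⟨hn, rfl⟩
    obtain ⟨γ, hγ, hdiag, hPQ, hcl⟩ := exists_hasCoxeterDiagram (by omega) hn' hk hP
    exact ⟨not_isCompact (by omega) hn' hγ hk (hPQ.trans_subset Set.inter_subset_left) hcl,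
      _, apex γ, hdiag, isPyramid hn hn' hγ hcl, isProductOfTwoSimplices hn hn' hγ hcl,
      idealVertices_eq (by omega) hn' hγ hk hcl⟩
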